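/- A rooted binary tree is a rooted tree in which every internal node has one or two children. Let $T$ be a rooted binary tree whose leaf set is a set $X$ of $n \ge 1$ items. A ranking of $X$ is a bijection $\rho : X \to \{1,\dots,n\}$. An ordering of $T$ fixes, at every internal node, an order of its children, and so induces a left-to-right ranking $\sigma$ of $X$. The number of inversions of $\sigma$ with respect to $\rho$ is the number of pairs $(x_1,x_2) \in X \times X$ with $\rho(x_1) < \rho(x_2)$ and $\sigma(x_1) > \sigma(x_2)$. Inversion minimization on $T$ is the problem $\Pi_T$ that asks, on input a ranking $\rho$ of $X$, for the minimum number of inversions with respect to $\rho$ over all rankings $\sigma$ induced by orderings of $T$. In the comparison-query model, a deterministic algorithm accesses $\rho$ only through adaptive queries of the form "is $\rho(x) < \rho(y)$?" with $x,y \in X$; the query complexity of a problem is the minimum, over all algorithms that output the correct answer on every ranking, of the maximum number of queries made over all input rankings. Theorem (lower bound for binary trees). For binary trees $T$ with $n$ leaves, the query complexity of inversion minimization on $T$ is at least $\log_2(n!) - O(\log n)$. That is, there is a universal constant $C$ such that for every $n \ge 1$ and every rooted binary tree $T$ with $n$ leaves, the query complexity of $\Pi_T$ is at least $\log_2(n!)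 - C \log_2 n$. -/

import Mathlib

universe u

namespace InversionMin

/-- A ranking of a finite set `X` of `n` items: a bijection from `X` to the `n` ranks
(ranks are numbered from `0`). -/
abbrev Ranking (X : Type*) [Fintype X] : Type _ := X ≃ Fin (Fintype.card X)

/-- The number of inversions of the ranking `σ` with respect to the ranking `ρ`: the pairs of items
`(x₁, x₂)` with `ρ x₁ < ρ x₂` but `σ x₁ > σ x₂`. -/
def inv {X : Type*} [Fintype X] (ρ σ : Ranking X) : ℕ :=
  (Finset.univ.filter fun p : X × X => ρ p.1 < ρ p.2 ∧ σ p.2 < σ p.1).card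

/-- Rooted binary trees with leaves labelled by items of `X`: a tree is a single leaf, or its root
has exactly one child, or its root has exactly two children. The two children of a node are written
in some order, but this order is immaterial for the notions below. -/
inductive LabelledBinaryTree (X : Type*) where
  | leaf (x : X) : LabelledBinaryTree X
  | unary (t : LabelledBinaryTree X) : LabelledBinaryTree X
  | node (l r : LabelledBinaryTree X) : LabelledBinaryTree X

namespace LabelledBinaryTree

/-- The labels of the leaves, from left to right as the tree is written. -/
def leaves {X : Type*} : LabelledBinaryTree X → List X
  | leaf x => [x]
  | unary t => t.leaves
  | node l r => l.leaves ++ r.leaves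

/-- `X` is the leaf set of `T`: every item of `X` labels exactly one leaf. -/
def HasLeafSet {X : Type*} (T : LabelledBinaryTree X) : Prop :=
  T.leaves.Nodup ∧ ∀ x : X, x ∈ T.leaves

/-- The left-to-right sequences of leaves that arise from the orderings of the tree, where an
ordering chooses, at every node independently, the order in which the children are visited. -/
def leafSequences {X : Type*} : LabelledBinaryTree X → Set (List X)
  | leaf x => {[x]}
  | unary t => t.leafSequences
  | node l r => {s | ∃ a ∈ l.leafSequences, ∃ b ∈ r.leafSequences, s = a ++ b ∨ s = b ++ a}

/-- The ranking `σ` is the left-to-right ranking of the leaves induced by some ordering of `T`. -/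
def IsInducedRanking {X : Type*} [Fintype X] (T : LabelledBinaryTree X) (σ : Ranking X) : Prop :=
  List.ofFn σ.symm ∈ T.leafSequences

/-- Inversion minimization on `T`: the minimum number of inversions with respect to `ρ` over all
rankings induced by orderings of `T`. -/
noncomputable def minInv {X : Type*} [Fintype X] (T : LabelledBinaryTree X) (ρ : Ranking X) : ℕ :=
  sInf {k | ∃ σ : Ranking X, T.IsInducedRanking σ ∧ inv ρ σ = k}

theorem leaves_mem_leafSequences {X : Type*} (T : LabelledBinaryTree X) :
    T.leaves ∈ T.leafSequences := by
  induction T with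
  | leaf x => simp [leaves, leafSequences]
  | unary t ih => simpa [leaves, leafSequences] using ih
  | node l r ihl ihr => exact ⟨_, ihl, _, ihr, Or.inl rfl⟩

/-- The minimum in `minInv` is over a nonempty set. -/
theorem exists_isInducedRanking {X : Type*} [Fintype X] (T : LabelledBinaryTree X)
    (hT : T.HasLeafSet) :
    ∃ σ : Ranking X, T.IsInducedRanking σ := by
  classical
  have hlen : T.leaves.length = Fintype.card X := by
    rw [← List.toFinset_card_of_nodup hT.1, ← Finset.card_univ]
    congr 1
    ext x
    simp [hT.2 x]
  let e : Fin T.leaves.length ≃ X := List.Nodup.getEquivOfForallMemList T.leaves hT.1 hT.2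
  refine ⟨((finCongr hlen).symm.trans e).symm, ?_⟩
  have h : List.ofFn ((finCongr hlen).symm.trans e) = T.leaves := by
    apply List.ext_getElem
    · simp [hlen]
    · intro i h1 h2
      simp [e]
  unfold IsInducedRanking
  rw [Equiv.symm_symm, h]
  exact T.leaves_mem_leafSequences

end LabelledBinaryTree

/-- Deterministic algorithms in the comparison-query model with items `X` and outputs in `β`:
either stop with an output, or ask whether `x` has smaller rank than `y` and continue depending on
the answer. -/
inductive Algorithm (X : Type*) (β : Type*) where
  | output (b : β) : Algorithm X β
  | query (x y : X) (ifYes ifNo : Algorithm X β) : Algorithm X β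

namespace Algorithm

/-- The output of an algorithm on the input ranking `ρ`. -/
def run {X β : Type*} [Fintype X] (ρ : Ranking X) : Algorithm X β → β
  | output b => b
  | query x y ifYes ifNo => if ρ x < ρ y then ifYes.run ρ else ifNo.run ρ

/-- The number of comparison queries that an algorithm makes on the input ranking `ρ`. -/
def numQueries {X β : Type*} [Fintype X] (ρ : Ranking X) : Algorithm X β → ℕ
  | output _ => 0
  | query x y ifYes ifNo =>
      (if ρ x < ρ y then ifYes.numQueries ρ else ifNo.numQueries ρ) + 1

/-- The algorithm outputs the value of `P` on every input ranking. -/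
def Solves {X β : Type*} [Fintype X] (A : Algorithm X β) (P : Ranking X → β) : Prop :=
  ∀ ρ : Ranking X, A.run ρ = P ρ

end Algorithm

/-- The query complexity of a problem `P`: the minimum, over all algorithms for `P`, of the maximum
number of queries over all input rankings. -/
noncomputable def queryComplexity {X β : Type*} [Fintype X] (P : Ranking X → β) : ℕ :=
  sInf {q | ∃ A : Algorithm X β, A.Solves P ∧ ∀ ρ : Ranking X, A.numQueries ρ ≤ q}

/-- Ask all queries of a list and apply `f` to the list of answers. -/
def askAll {X β : Type*} : List (X × X) → (List Bool → β) → Algorithm X β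
  | [], f => .output (f [])
  | p :: l, f =>
      .query p.1 p.2 (askAll l fun a => f (true :: a)) (askAll l fun a => f (false :: a))

theorem run_askAll {X β : Type*} [Fintype X] (ρ : Ranking X) (l : List (X × X))
    (f : List Bool → β) :
    (askAll l f).run ρ = f (l.map fun p => decide (ρ p.1 < ρ p.2)) := by
  induction l generalizing f with
  | nil => rfl
  | cons p l ih =>
    by_cases h : ρ p.1 < ρ p.2 <;> simp [askAll, Algorithm.run, ih, h]

theorem numQueries_askAll {X β : Type*} [Fintype X] (ρ : Ranking X) (l : List (X × X))
    (f : List Bool → β) : (askAll l f).numQueries ρ = l.length := by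
  induction l generalizing f with
  | nil => rfl
  | cons p l ih => simp [askAll, Algorithm.numQueries, ih]

/-- The minimum in `queryComplexity` is over a nonempty set: comparing all pairs of items determines
the ranking. -/
theorem exists_solves {X β : Type*} [Fintype X] (P : Ranking X → β) :
    ∃ q, ∃ A : Algorithm X β, A.Solves P ∧ ∀ ρ : Ranking X, A.numQueries ρ ≤ q := by
  classical
  let l : List (X × X) := (Finset.univ : Finset (X × X)).toList
  let ans : Ranking X → List Bool := fun ρ => l.map fun p => decide (ρ p.1 < ρ p.2)
  have hinj : Function.Injective ans := by
    intro ρ τ h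
    have hlt : ∀ x y, ρ x < ρ y ↔ τ x < τ y := by
      intro x y
      have := List.map_inj_left.1 h (x, y) (by simp [l])
      simpa using this
    let e : Fin (Fintype.card X) ≃o Fin (Fintype.card X) :=
      { toEquiv := ρ.symm.trans τ
        map_rel_iff' := by
          intro a b
          have := hlt (ρ.symm b) (ρ.symm a)
          simp only [Equiv.apply_symm_apply] at this
          simp only [Equiv.trans_apply]
          rw [← not_lt, ← not_lt, this] }
    have he : e = OrderIso.refl _ := Subsingleton.elim _ _
    ext x
    have := congrArg (fun g : Fin (Fintype.card X) ≃o Fin (Fintype.card X) => g (ρ x)) he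
    simp [e] at this
    rw [this]
  let b : β := P (Fintype.equivFin X)
  refine ⟨l.length, askAll l (Function.extend ans P fun _ => b), ?_, ?_⟩
  · intro ρ
    rw [run_askAll]
    exact hinj.extend_apply P _ ρ
  · intro ρ
    rw [numQueries_askAll]

end InversionMin

/-! The proof plays the answers of an algorithm against the sensitivity of the problem. With at most
`q` queries there are at most `2 ^ q` transcripts. Rankings with the same transcript extend the
relation `E` formed by the answers. If `u` lies directly below `w` and `E` does not contain this
comparison, exchanging them leaves all answers, hence the output, unchanged, so `w` is insensitive.
A linear extension of `E` is determined by the ordered list of its jumps (`eq_of_jumps_eq`), and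
every jump is the bottom item or insensitive. So at most `2 ^ q * (n + 1) ^ (K + 1)` rankings have
at most `K` insensitive items. It remains to show that the average number of insensitive items is
bounded by a constant.

The minimum is a sum over nodes of `min (below B S) (below S B)`, where `B` and `S` are the leaf
sets of the children. Exchanging neighbours `u`, `w` affects only the node separating them and
changes its two counts by one in opposite directions, so the minimum is kept only if the counts are
nearly equal.

Let `S` be the smaller side and `y ∈ S`. Given the order of the other items, the exact value of
`below B S` fixes how many items of `B` lie below `y`; adjacency to `B` on a given side then fixes
the position of `y`. Deleting `y` therefore loses nothing and leaves a ranking whose count lies in a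
window of length `|B|`. Up to a constant, this count is the sum of a random subset of positions, and
such sums are spread out (`card_sum_mem_Ico_le`), so the window has probability `O(1 / √|S|)`.
Restoring the position of `y` gives another factor `1 / n`. Summing over `y`, a node contributes
`O(√|S| / n)` on average, and the square roots of the smaller sides over all nodes of a binary tree
add up to `O(n)`. -/

namespace InversionMin

/-! ### Transcripts of decision trees -/

section Query

variable {X β : Type*} [Fintype X]

/-- A ranking is determined by the comparisons between the items. -/
theorem Ranking.ext_of_lt_iff {ρ τ : Ranking X} (h : ∀ x y, ρ x < ρ y ↔ τ x < τ y) : ρ = τ := by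
  let e : Fin (Fintype.card X) ≃o Fin (Fintype.card X) :=
    { toEquiv := ρ.symm.trans τ
      map_rel_iff' := by
        intro a b
        have := h (ρ.symm b) (ρ.symm a)
        simp only [Equiv.apply_symm_apply] at this
        simp only [Equiv.trans_apply]
        rw [← not_lt, ← not_lt, this] }
  have he : e = OrderIso.refl _ := Subsingleton.elim _ _
  ext x
  have := congrArg (fun g : Fin (Fintype.card X) ≃o Fin (Fintype.card X) => g (ρ x)) he
  simp [e] at this
  rw [this]

namespace Algorithm

/-- The queries that an algorithm makes on a ranking, with the answers. -/
def transcript (ρ : Ranking X) : Algorithm X β → List ((X × X) × Bool)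
  | output _ => []
  | query x y a b =>
      if ρ x < ρ y then ((x, y), true) :: a.transcript ρ else ((x, y), false) :: b.transcript ρ

theorem answer_of_mem_transcript {ρ : Ranking X} {A : Algorithm X β} {p : (X × X) × Bool}
    (hp : p ∈ A.transcript ρ) : decide (ρ p.1.1 < ρ p.1.2) = p.2 := by
  induction A with
  | output b => simp [transcript] at hp
  | query x y a b iha ihb =>
    by_cases h : ρ x < ρ y
    · simp only [transcript, h, if_true, List.mem_cons] at hp
      rcases hp with rfl | hp
      · simpa using h
      · exact iha hp
    · simp only [transcript, h, if_false, List.mem_cons] at hp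
      rcases hp with rfl | hp
      · simpa using h
      · exact ihb hp

/-- A ranking that gives the recorded answers follows the same path through the decision tree. -/
theorem run_eq_of_consistent {ρ τ : Ranking X} {A : Algorithm X β}
    (h : ∀ p ∈ A.transcript ρ, decide (τ p.1.1 < τ p.1.2) = p.2) : A.run τ = A.run ρ := by
  induction A with
  | output b => rfl
  | query x y a b iha ihb =>
    by_cases hxy : ρ x < ρ y
    · simp only [transcript, hxy, if_true, List.mem_cons, forall_eq_or_imp, decide_eq_true_eq] at h
      simp only [run, hxy, h.1, if_true]
      exact iha h.2
    · simp only [transcript, hxy, if_false, List.mem_cons, forall_eq_or_imp,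
        decide_eq_false_iff_not] at h
      simp only [run, hxy, h.1, if_false]
      exact ihb h.2

/-- A transcript is a path in the decision tree. The query bound is assumed only on `S`, because
after the first query the smaller bound is known only for the rankings that take the branch in
question. -/
theorem card_image_transcript_le [DecidableEq X] (A : Algorithm X β) (q : ℕ)
    (S : Finset (Ranking X)) (hS : ∀ ρ ∈ S, A.numQueries ρ ≤ q) :
    (S.image fun ρ => A.transcript ρ).card ≤ 2 ^ q := by
  induction A generalizing q S with
  | output b =>
    calc _ ≤ ({[]} : Finset (List ((X × X) × Bool))).card := by
          apply Finset.card_le_card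
          intro l hl
          obtain ⟨ρ, -, rfl⟩ := Finset.mem_image.1 hl
          simp [transcript]
      _ ≤ 2 ^ q := by simpa using Nat.one_le_two_pow
  | query x y a b iha ihb =>
    rcases S.eq_empty_or_nonempty with rfl | ⟨ρ₀, hρ₀⟩
    · simp
    obtain ⟨q, rfl⟩ : ∃ q', q = q' + 1 := by
      have := hS ρ₀ hρ₀
      simp only [numQueries] at this
      exact ⟨q - 1, by omega⟩
    have hyes := iha q (S.filter fun ρ => ρ x < ρ y) (by
      intro ρ hρ
      obtain ⟨h1, h2⟩ := Finset.mem_filter.1 hρ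
      have := hS ρ h1
      simp only [numQueries, h2, if_true] at this
      omega)
    have hno := ihb q (S.filter fun ρ => ¬ ρ x < ρ y) (by
      intro ρ hρ
      obtain ⟨h1, h2⟩ := Finset.mem_filter.1 hρ
      have := hS ρ h1
      simp only [numQueries, h2, if_false] at this
      omega)
    calc _ ≤ (((S.filter fun ρ => ρ x < ρ y).image fun ρ => a.transcript ρ).image
              (List.cons ((x, y), true)) ∪
            ((S.filter fun ρ => ¬ ρ x < ρ y).image fun ρ => b.transcript ρ).image
              (List.cons ((x, y), false))).card := by
          apply Finset.card_le_card
          intro l hl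
          obtain ⟨ρ, hρ, rfl⟩ := Finset.mem_image.1 hl
          by_cases h : ρ x < ρ y
          · refine Finset.mem_union_left _ (Finset.mem_image.2 ⟨a.transcript ρ, ?_, ?_⟩)
            · exact Finset.mem_image_of_mem _ (Finset.mem_filter.2 ⟨hρ, h⟩)
            · simp [transcript, h]
          · refine Finset.mem_union_right _ (Finset.mem_image.2 ⟨b.transcript ρ, ?_, ?_⟩)
            · exact Finset.mem_image_of_mem _ (Finset.mem_filter.2 ⟨hρ, h⟩)
            · simp [transcript, h]
      _ ≤ 2 ^ q + 2 ^ q := (Finset.card_union_le _ _).trans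
          (Nat.add_le_add (Finset.card_image_le.trans hyes) (Finset.card_image_le.trans hno))
      _ = 2 ^ (q + 1) := by ring

end Algorithm

/-! ### Linear extensions, jumps and insensitive items -/

open Classical in
/-- The items that are not directly preceded in the ranking by an item that `E` puts below them. -/
noncomputable def jumps (E : X → X → Prop) (ρ : Ranking X) : Finset X :=
  Finset.univ.filter fun w => ¬ ∃ u, (ρ u : ℕ) + 1 = ρ w ∧ E u w

theorem mem_jumps {E : X → X → Prop} {ρ : Ranking X} {w : X} :
    w ∈ jumps E ρ ↔ ¬ ∃ u, (ρ u : ℕ) + 1 = ρ w ∧ E u w := by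
  simp [jumps]

/-- An item that is available but not placed next by a linear extension becomes a jump. -/
theorem not_lt_of_not_mem_jumps {E : X → X → Prop} {ρ τ : Ranking X}
    (hρ : ∀ u w, E u w → ρ u < ρ w) {x y : X} (hagree : ∀ z, ρ z < ρ x → τ z = ρ z)
    (hy : (τ y : ℕ) = ρ x) (hx : x ∉ jumps E τ) : ¬ τ y < τ x := by
  intro hlt
  rw [mem_jumps, not_not] at hx
  obtain ⟨z, hz, hE⟩ := hx
  have h1 := hρ z x hE
  have h2 := hagree z h1
  rw [Fin.lt_def] at h1 hlt
  rw [Fin.ext_iff] at h2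
  omega

/-- A linear extension is determined by its jumps and their relative order. -/
theorem eq_of_jumps_eq {E : X → X → Prop} {ρ τ : Ranking X}
    (hρ : ∀ u w, E u w → ρ u < ρ w) (hτ : ∀ u w, E u w → τ u < τ w)
    (hJ : jumps E ρ = jumps E τ)
    (hord : ∀ x ∈ jumps E ρ, ∀ y ∈ jumps E ρ, x ≠ y → (ρ x < ρ y ↔ τ x < τ y)) : ρ = τ := by
  have key : ∀ (r : ℕ) (x : X), (ρ x : ℕ) = r → τ x = ρ x := by
    intro r
    induction r using Nat.strong_induction_on with
    | _ r ih =>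
      intro x hx
      -- At the first rank where the rankings differ, `ρ` places `x` and `τ` places `y`. Each comes
      -- later in the other ranking, which makes `x` a jump of `τ` and `y` a jump of `ρ`. The jump
      -- sets coincide, but `x` and `y` are ordered differently.
      set y := τ.symm (ρ x) with hy
      have hτy : τ y = ρ x := by simp [hy]
      by_contra hne
      have hxy : x ≠ y := by
        rintro h
        rw [← h] at hτy
        exact hne hτy
      have h1 : ∀ z, ρ z < ρ x → τ z = ρ z := by
        intro z hz
        exact ih (ρ z) (by rw [← hx]; exact hz) z rfl
      have h2 : ∀ z, τ z < τ y → ρ z = τ z := by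
        intro z hz
        have h3 : τ (ρ.symm (τ z)) = ρ (ρ.symm (τ z)) := h1 _ (by simpa [hτy] using hz)
        rw [Equiv.apply_symm_apply, τ.apply_eq_iff_eq] at h3
        exact (ρ.symm_apply_eq.1 h3).symm
      have hρy : ρ x < ρ y := by
        rcases lt_trichotomy (ρ y) (ρ x) with h | h | h
        · have := h1 y h
          rw [hτy] at this
          exact absurd (ρ.injective this) hxy
        · exact absurd (ρ.injective h).symm hxy
        · exact h
      have hτx : τ y < τ x := by
        rcases lt_trichotomy (τ y) (τ x) with h | h | h
        · exact h
        · exact absurd (τ.injective h).symm hxy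
        · have := h2 x h
          exact absurd this.symm hne
      have hxJ : x ∈ jumps E τ := by
        by_contra hc
        exact not_lt_of_not_mem_jumps hρ h1 (by rw [hτy]) hc hτx
      have hyJ : y ∈ jumps E ρ := by
        by_contra hc
        exact not_lt_of_not_mem_jumps hτ h2 (by rw [hτy]) hc hρy
      have := (hord x (hJ ▸ hxJ) y hyJ hxy).1 hρy
      exact absurd this (not_lt.2 hτx.le)
  ext x
  rw [key _ x rfl]

/-- A list of the elements of `J` in the order of the ranking. -/
theorem exists_sorted_list (ρ : Ranking X) (J : Finset X) :
    ∃ l : List X, l.length = J.card ∧ (∀ x, x ∈ l ↔ x ∈ J) ∧ l.Pairwise fun x y => ρ x < ρ y := by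
  classical
  refine ⟨((J.map ρ.toEmbedding).sort (· ≤ ·)).map ρ.symm, by simp, ?_, ?_⟩
  · intro x
    simp only [List.mem_map, Finset.mem_sort, Finset.mem_map_equiv]
    constructor
    · rintro ⟨a, ha, rfl⟩
      exact ha
    · intro h
      exact ⟨ρ x, by simpa using h, by simp⟩
  · rw [List.pairwise_map]
    simpa using (J.map ρ.toEmbedding).sortedLT_sort.pairwise

theorem card_lists_le (S : Finset (List X)) (K : ℕ) (hS : ∀ l ∈ S, l.length ≤ K) :
    S.card ≤ (Fintype.card X + 1) ^ K := by
  classical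
  have : S.card ≤ (Finset.univ : Finset (Fin K → Option X)).card := by
    apply Finset.card_le_card_of_injOn (fun (l : List X) (i : Fin K) => l[(i : ℕ)]?)
      (by simp)
    intro l hl l' hl' h
    apply List.ext_getElem?
    intro i
    by_cases hi : i < K
    · exact congrFun h ⟨i, hi⟩
    · rw [List.getElem?_eq_none (by have := hS l hl; omega),
        List.getElem?_eq_none (by have := hS l' hl'; omega)]
  simpa using this

/-- By `eq_of_jumps_eq`, listing the jumps in increasing order is an injective encoding of linear
extensions. -/
theorem card_le_of_jumps_le (E : X → X → Prop) (K : ℕ) (S : Finset (Ranking X))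
    (hE : ∀ ρ ∈ S, ∀ u w, E u w → ρ u < ρ w) (hK : ∀ ρ ∈ S, (jumps E ρ).card ≤ K) :
    S.card ≤ (Fintype.card X + 1) ^ K := by
  classical
  choose L hlen hmem hpair using fun ρ : Ranking X => exists_sorted_list ρ (jumps E ρ)
  have hinj : Set.InjOn L S := by
    intro ρ hρ τ hτ h
    have hJ : jumps E ρ = jumps E τ := by
      ext x
      rw [← hmem, ← hmem, h]
    refine eq_of_jumps_eq (hE ρ hρ) (hE τ hτ) hJ ?_
    have h2 : (L ρ).Pairwise fun x y => (ρ x < ρ y ∧ τ x < τ y) :=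
      (hpair ρ).and (h ▸ hpair τ)
    -- Both directions are recorded to make the relation symmetric, as `List.Pairwise.forall`
    -- requires.
    have h3 : (L ρ).Pairwise fun x y => (ρ x < ρ y ↔ τ x < τ y) ∧ (ρ y < ρ x ↔ τ y < τ x) :=
      h2.imp fun {x y} h => ⟨iff_of_true h.1 h.2, iff_of_false h.1.not_gt h.2.not_gt⟩
    intro x hx y hy hxy
    have hs : Std.Symm fun x y => (ρ x < ρ y ↔ τ x < τ y) ∧ (ρ y < ρ x ↔ τ y < τ x) :=
      ⟨fun x y h => ⟨h.2, h.1⟩⟩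
    exact (h3.forall ((hmem ρ x).2 hx) ((hmem ρ y).2 hy) hxy).1
  rw [← Finset.card_image_of_injOn hinj]
  apply card_lists_le
  intro l hl
  obtain ⟨ρ, hρ, rfl⟩ := Finset.mem_image.1 hl
  rw [hlen]
  exact hK ρ hρ

open Classical in
/-- The items that can be exchanged with the item directly below them without changing `P`. -/
noncomputable def insensitive (P : Ranking X → β) (ρ : Ranking X) : Finset X :=
  Finset.univ.filter fun w => ∃ u, (ρ u : ℕ) + 1 = ρ w ∧ P ((Equiv.swap u w).trans ρ) = P ρ

/-- Exchanging two items of adjacent ranks changes only the comparison between these two. -/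
theorem swap_lt_swap_iff [DecidableEq X] {ρ : Ranking X} {u w : X} (h : (ρ u : ℕ) + 1 = ρ w)
    {x y : X} (h1 : ¬ (x = u ∧ y = w)) (h2 : ¬ (x = w ∧ y = u)) :
    ((Equiv.swap u w).trans ρ) x < ((Equiv.swap u w).trans ρ) y ↔ ρ x < ρ y := by
  have hne : ∀ {a b : X}, a ≠ b → (ρ a : ℕ) ≠ ρ b := fun hab hc =>
    hab (ρ.injective (Fin.ext hc))
  have huw : u ≠ w := by
    rintro rfl
    omega
  simp only [Equiv.trans_apply, Equiv.swap_apply_def, Fin.lt_def]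
  split_ifs with hxu hyu hyw hxw hyu hyw hyu hyw <;> subst_vars <;> simp_all
  all_goals grind

/-- The rankings of `S` are grouped by transcript. Within a group, a jump other than the bottom item
was never compared with its predecessor, so correctness of the algorithm makes it insensitive. -/
theorem card_insensitive_le_of_solves (P : Ranking X → β) (A : Algorithm X β) (hA : A.Solves P)
    (q : ℕ) (hq : ∀ ρ, A.numQueries ρ ≤ q) (K : ℕ) (S : Finset (Ranking X))
    (hS : ∀ ρ ∈ S, (insensitive P ρ).card ≤ K) :
    S.card ≤ 2 ^ q * (Fintype.card X + 1) ^ (K + 1) := by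
  classical
  have himg := A.card_image_transcript_le q S (fun ρ _ => hq ρ)
  refine (Finset.card_le_mul_card_image S ((Fintype.card X + 1) ^ (K + 1))
    (f := fun ρ => A.transcript ρ) ?_).trans ?_
  · intro t ht
    -- A negative answer to `(w, u)` puts `u` below `w` only if they differ, since comparing an item
    -- with itself is also answered negatively.
    let E : X → X → Prop := fun u w =>
      ((u, w), true) ∈ t ∨ (((w, u), false) ∈ t ∧ u ≠ w)
    apply card_le_of_jumps_le E
    · intro ρ hρ u w huw
      obtain ⟨-, rfl⟩ := Finset.mem_filter.1 hρ
      rcases huw with h | ⟨h, hne⟩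
      · simpa using Algorithm.answer_of_mem_transcript h
      · have := Algorithm.answer_of_mem_transcript h
        simp only [decide_eq_false_iff_not, not_lt] at this
        exact lt_of_le_of_ne this fun hc => hne (ρ.injective hc)
    · intro ρ hρ
      obtain ⟨hρS, rfl⟩ := Finset.mem_filter.1 hρ
      have hsub : jumps E ρ ⊆ (Finset.univ.filter fun w => (ρ w : ℕ) = 0) ∪ insensitive P ρ := by
        intro w hw
        rw [mem_jumps] at hw
        by_cases h0 : (ρ w : ℕ) = 0
        · exact Finset.mem_union_left _ (by simpa using h0)
        refine Finset.mem_union_right _ (Finset.mem_filter.2 ⟨Finset.mem_univ _, ?_⟩)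
        have hlt : (ρ w : ℕ) - 1 < Fintype.card X := by have := (ρ w).2; omega
        set u := ρ.symm ⟨(ρ w : ℕ) - 1, hlt⟩ with hu
        have huw : (ρ u : ℕ) + 1 = ρ w := by
          simp only [hu, Equiv.apply_symm_apply]
          omega
        have hne : u ≠ w := by
          intro hc
          rw [hc] at huw
          omega
        refine ⟨u, huw, ?_⟩
        rw [← hA, ← hA]
        apply Algorithm.run_eq_of_consistent
        rintro ⟨⟨x, y⟩, b⟩ hp
        rw [← Algorithm.answer_of_mem_transcript hp]
        have hans := Algorithm.answer_of_mem_transcript hp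
        have hulw : ρ u < ρ w := by rw [Fin.lt_def]; omega
        congr 1
        rw [eq_iff_iff]
        apply swap_lt_swap_iff huw
        · rintro ⟨hx, hy⟩
          dsimp only at hx hy hp hans
          rw [hx, hy] at hp hans
          apply hw
          refine ⟨u, huw, Or.inl ?_⟩
          simp only [hulw, decide_true] at hans
          rwa [hans]
        · rintro ⟨hx, hy⟩
          dsimp only at hx hy hp hans
          rw [hx, hy] at hp hans
          apply hw
          refine ⟨u, huw, Or.inr ⟨?_, hne⟩⟩
          simp only [hulw.not_gt, decide_false] at hans
          rwa [hans]
      -- The bottom item has no predecessor and is always a jump; it accounts for the `+ 1` in the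
      -- exponent.
      have h0 : (Finset.univ.filter fun w => (ρ w : ℕ) = 0).card ≤ 1 := by
        rw [Finset.card_le_one]
        intro a ha b hb
        simp only [Finset.mem_filter, Finset.mem_univ, true_and] at ha hb
        exact ρ.injective (Fin.ext (ha.trans hb.symm))
      have := (Finset.card_le_card hsub).trans (Finset.card_union_le _ _)
      have := hS ρ hρS
      omega
  · rw [mul_comm]
    exact Nat.mul_le_mul_right _ himg

end Query

/-! ### The minimum as a sum over the nodes -/

section Cost

variable {X : Type*} [Fintype X]

/-- The number of pairs in `B × S` whose first item has the smaller rank. -/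
def below (ρ : Ranking X) (B S : Finset X) : ℕ :=
  ((B ×ˢ S).filter fun p => ρ p.1 < ρ p.2).card

theorem below_add_below (ρ : Ranking X) {B S : Finset X} (h : Disjoint B S) :
    below ρ B S + below ρ S B = B.card * S.card := by
  rw [← Finset.card_product, ← Finset.card_filter_add_card_filter_not (s := B ×ˢ S)
    (fun p => ρ p.1 < ρ p.2), below, below]
  congr 1
  refine Finset.card_bij' (fun p _ => p.swap) (fun p _ => p.swap) ?_ ?_ (by simp) (by simp)
  · rintro ⟨x, y⟩ hp
    simp only [Finset.mem_filter, Finset.mem_product, Prod.swap_prod_mk, not_lt] at hp ⊢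
    exact ⟨hp.1.symm, hp.2.le⟩
  · rintro ⟨x, y⟩ hp
    simp only [Finset.mem_filter, Finset.mem_product, Prod.swap_prod_mk, not_lt] at hp ⊢
    refine ⟨hp.1.symm, lt_of_le_of_ne hp.2 fun hc => ?_⟩
    have := ρ.injective hc
    subst this
    exact Finset.disjoint_left.1 h hp.1.1 hp.1.2

theorem below_swap_of_not_split [DecidableEq X] {ρ : Ranking X} {u w : X}
    (h : (ρ u : ℕ) + 1 = ρ w) {B S : Finset X} (h1 : ¬ (u ∈ B ∧ w ∈ S))
    (h2 : ¬ (w ∈ B ∧ u ∈ S)) : below ((Equiv.swap u w).trans ρ) B S = below ρ B S := by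
  unfold below
  congr 1
  apply Finset.filter_congr
  rintro ⟨x, y⟩ hp
  rw [Finset.mem_product] at hp
  apply swap_lt_swap_iff h
  · rintro ⟨rfl, rfl⟩
    exact h1 hp
  · rintro ⟨rfl, rfl⟩
    exact h2 hp

theorem below_swap_of_split [DecidableEq X] {ρ : Ranking X} {u w : X}
    (h : (ρ u : ℕ) + 1 = ρ w) {B S : Finset X} (hd : Disjoint B S) (hu : u ∈ B) (hw : w ∈ S) :
    below ρ B S = below ((Equiv.swap u w).trans ρ) B S + 1 := by
  unfold below
  have hlt : ρ u < ρ w := by rw [Fin.lt_def]; omega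
  rw [← Finset.card_insert_of_notMem (a := (u, w))]
  · congr 1
    ext ⟨x, y⟩
    simp only [Finset.mem_insert, Finset.mem_filter, Finset.mem_product]
    by_cases hxy : x = u ∧ y = w
    · obtain ⟨rfl, rfl⟩ := hxy
      simp [hu, hw, hlt]
    · have hne : ¬ ((x, y) = (u, w)) := fun hc => hxy (Prod.mk.inj hc)
      simp only [hne, false_or]
      refine and_congr_right fun hxy' => (swap_lt_swap_iff h hxy ?_).symm
      rintro ⟨rfl, rfl⟩
      exact Finset.disjoint_left.1 hd hxy'.1 hw
  · intro hc
    have := (Finset.mem_filter.1 hc).2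
    simp only [Equiv.trans_apply, Equiv.swap_apply_left, Equiv.swap_apply_right] at this
    exact hlt.not_gt this

/-- The number of inversions among the items of `A`. -/
def invOn (ρ σ : Ranking X) (A : Finset X) : ℕ :=
  ((A ×ˢ A).filter fun p => ρ p.1 < ρ p.2 ∧ σ p.2 < σ p.1).card

/-- Since `σ` puts `A` entirely before `B`, a mixed pair is inverted exactly when `ρ` ranks its item
of `B` lower. -/
theorem invOn_union [DecidableEq X] (ρ σ : Ranking X) {A B : Finset X}
    (h : ∀ a ∈ A, ∀ b ∈ B, σ a < σ b) :
    invOn ρ σ (A ∪ B) = invOn ρ σ A + invOn ρ σ B + below ρ B A := by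
  have hd : Disjoint A B := Finset.disjoint_left.2 fun a ha hb => lt_irrefl _ (h a ha a hb)
  unfold invOn below
  rw [← Finset.card_union_of_disjoint, ← Finset.card_union_of_disjoint]
  · congr 1
    ext ⟨x, y⟩
    simp only [Finset.mem_union, Finset.mem_filter, Finset.mem_product]
    constructor
    · rintro ⟨⟨hx | hx, hy | hy⟩, h1, h2⟩
      · exact Or.inl (Or.inl ⟨⟨hx, hy⟩, h1, h2⟩)
      · exact absurd h2 (h x hx y hy).not_gt
      · exact Or.inr ⟨⟨hx, hy⟩, h1⟩
      · exact Or.inl (Or.inr ⟨⟨hx, hy⟩, h1, h2⟩)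
    · rintro ((⟨⟨hx, hy⟩, h1, h2⟩ | ⟨⟨hx, hy⟩, h1, h2⟩) | ⟨⟨hx, hy⟩, h1⟩)
      · exact ⟨⟨Or.inl hx, Or.inl hy⟩, h1, h2⟩
      · exact ⟨⟨Or.inr hx, Or.inr hy⟩, h1, h2⟩
      · exact ⟨⟨Or.inr hx, Or.inl hy⟩, h1, h y hy x hx⟩
  · rw [Finset.disjoint_left]
    rintro ⟨x, y⟩ hp hq
    simp only [Finset.mem_union, Finset.mem_filter, Finset.mem_product] at hp hq
    rcases hp with hp | hp
    · exact Finset.disjoint_left.1 hd hp.1.1 hq.1.1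
    · exact Finset.disjoint_left.1 hd hq.1.2 hp.1.2
  · rw [Finset.disjoint_left]
    rintro ⟨x, y⟩ hp hq
    simp only [Finset.mem_filter, Finset.mem_product] at hp hq
    exact Finset.disjoint_left.1 hd hp.1.1 hq.1.1

namespace LabelledBinaryTree

open Classical in
/-- The set of the labels of the leaves. -/
noncomputable def leafSet {X : Type*} (T : LabelledBinaryTree X) : Finset X := T.leaves.toFinset

theorem mem_leafSet {X : Type*} {T : LabelledBinaryTree X} {x : X} :
    x ∈ T.leafSet ↔ x ∈ T.leaves := by
  simp [leafSet]

theorem mem_leafSet_node {X : Type*} {l r : LabelledBinaryTree X} {x : X} :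
    x ∈ (node l r).leafSet ↔ x ∈ l.leafSet ∨ x ∈ r.leafSet := by
  simp [mem_leafSet, leaves]

theorem leafSet_node {X : Type*} [DecidableEq X] (l r : LabelledBinaryTree X) :
    (node l r).leafSet = l.leafSet ∪ r.leafSet := by
  ext x
  simp [mem_leafSet_node]

theorem disjoint_leafSet {X : Type*} {l r : LabelledBinaryTree X} (h : (node l r).leaves.Nodup) :
    Disjoint l.leafSet r.leafSet := by
  rw [Finset.disjoint_left]
  intro x hl hr
  rw [mem_leafSet] at hl hr
  exact (List.nodup_append.1 h).2.2 x hl x hr rfl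

/-- The minimum number of inversions, computed separately at every node. -/
noncomputable def cost (ρ : Ranking X) : LabelledBinaryTree X → ℕ
  | leaf _ => 0
  | unary t => t.cost ρ
  | node l r => l.cost ρ + r.cost ρ + min (below ρ l.leafSet r.leafSet) (below ρ r.leafSet l.leafSet)

theorem perm_of_mem_leafSequences {X : Type*} {T : LabelledBinaryTree X} {s : List X}
    (hs : s ∈ T.leafSequences) : s.Perm T.leaves := by
  induction T generalizing s with
  | leaf x =>
    rw [leafSequences, Set.mem_singleton_iff] at hs
    rw [hs, leaves]
  | unary t ih => exact ih hs
  | node l r ihl ihr =>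
    obtain ⟨a, ha, b, hb, rfl | rfl⟩ := hs
    · exact (ihl ha).append (ihr hb)
    · exact List.perm_append_comm.trans ((ihl ha).append (ihr hb))

theorem invOn_append {ρ σ : Ranking X} {l r : LabelledBinaryTree X} {a b : List X}
    (ha : a ∈ l.leafSequences) (hb : b ∈ r.leafSequences)
    (h : ∀ x ∈ a, ∀ y ∈ b, σ x < σ y) :
    invOn ρ σ (node l r).leafSet =
      invOn ρ σ l.leafSet + invOn ρ σ r.leafSet + below ρ r.leafSet l.leafSet := by
  classical
  rw [leafSet_node]
  apply invOn_union
  intro x hx y hy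
  rw [mem_leafSet] at hx hy
  exact h x ((perm_of_mem_leafSequences ha).mem_iff.2 hx) y
    ((perm_of_mem_leafSequences hb).mem_iff.2 hy)

theorem leafSet_node_comm {X : Type*} (l r : LabelledBinaryTree X) :
    (node l r).leafSet = (node r l).leafSet := by
  ext x
  simp [mem_leafSet_node, or_comm]

theorem cost_le_invOn {ρ σ : Ranking X} {T : LabelledBinaryTree X} {s : List X}
    (hs : s ∈ T.leafSequences) (hσ : s.Pairwise fun x y => σ x < σ y) :
    T.cost ρ ≤ invOn ρ σ T.leafSet := by
  induction T generalizing s with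
  | leaf x => simp [cost]
  | unary t ih => exact ih hs hσ
  | node l r ihl ihr =>
    obtain ⟨a, ha, b, hb, rfl | rfl⟩ := hs
    · rw [List.pairwise_append] at hσ
      rw [invOn_append ha hb hσ.2.2, cost]
      have h1 := ihl ha hσ.1
      have h2 := ihr hb hσ.2.1
      omega
    · rw [List.pairwise_append] at hσ
      rw [leafSet_node_comm, invOn_append hb ha hσ.2.2, cost]
      have h1 := ihl ha hσ.2.1
      have h2 := ihr hb hσ.1
      omega

/-- Orders at different nodes are chosen independently, so the cheaper one can be taken at every
node at once. The claim covers every `σ` increasing along `s`, because `s` may list only the leaves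
of a subtree. -/
theorem exists_leafSequence_cost (ρ : Ranking X) (T : LabelledBinaryTree X) :
    ∃ s ∈ T.leafSequences, ∀ σ : Ranking X, (s.Pairwise fun x y => σ x < σ y) →
      invOn ρ σ T.leafSet = T.cost ρ := by
  induction T with
  | leaf x =>
    refine ⟨[x], rfl, fun σ _ => ?_⟩
    simp [invOn, leafSet, leaves, cost]
  | unary t ih => exact ih
  | node l r ihl ihr =>
    obtain ⟨a, ha, ha'⟩ := ihl
    obtain ⟨b, hb, hb'⟩ := ihr
    rcases le_total (below ρ l.leafSet r.leafSet) (below ρ r.leafSet l.leafSet) with h | h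
    · refine ⟨b ++ a, ⟨a, ha, b, hb, Or.inr rfl⟩, fun σ hσ => ?_⟩
      rw [List.pairwise_append] at hσ
      rw [leafSet_node_comm, invOn_append hb ha hσ.2.2, cost, ha' σ hσ.2.1, hb' σ hσ.1]
      omega
    · refine ⟨a ++ b, ⟨a, ha, b, hb, Or.inl rfl⟩, fun σ hσ => ?_⟩
      rw [List.pairwise_append] at hσ
      rw [invOn_append ha hb hσ.2.2, cost, ha' σ hσ.1, hb' σ hσ.2.1]
      omega

theorem exists_ranking_of_leafSequence {T : LabelledBinaryTree X} (hT : T.HasLeafSet)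
    {s : List X} (hs : s ∈ T.leafSequences) : ∃ σ : Ranking X, List.ofFn σ.symm = s := by
  classical
  have hp := perm_of_mem_leafSequences hs
  have hnd : s.Nodup := hp.nodup_iff.2 hT.1
  have hall : ∀ x, x ∈ s := fun x => hp.mem_iff.2 (hT.2 x)
  have hlen : s.length = Fintype.card X := by
    rw [← List.toFinset_card_of_nodup hnd, ← Finset.card_univ]
    congr 1
    ext x
    simp [hall x]
  refine ⟨((finCongr hlen).symm.trans (List.Nodup.getEquivOfForallMemList s hnd hall)).symm, ?_⟩
  rw [Equiv.symm_symm]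
  apply List.ext_getElem
  · simp [hlen]
  · intro i h1 h2
    simp

theorem pairwise_ofFn_symm (σ : Ranking X) : (List.ofFn σ.symm).Pairwise fun x y => σ x < σ y := by
  rw [List.pairwise_ofFn]
  intro i j h
  simpa using h

theorem leafSet_eq_univ {T : LabelledBinaryTree X} (hT : T.HasLeafSet) :
    T.leafSet = Finset.univ := by
  ext x
  simp [mem_leafSet, hT.2 x]

theorem minInv_eq_cost {T : LabelledBinaryTree X} (hT : T.HasLeafSet) (ρ : Ranking X) :
    T.minInv ρ = T.cost ρ := by
  have huniv : ∀ σ, inv ρ σ = invOn ρ σ T.leafSet := by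
    intro σ
    rw [leafSet_eq_univ hT, invOn, Finset.univ_product_univ, inv]
  apply le_antisymm
  · obtain ⟨s, hs, hs'⟩ := exists_leafSequence_cost ρ T
    obtain ⟨σ, rfl⟩ := exists_ranking_of_leafSequence hT hs
    exact Nat.sInf_le ⟨σ, hs, by rw [huniv, hs' σ (pairwise_ofFn_symm σ)]⟩
  · apply le_csInf
    · obtain ⟨σ, hσ⟩ := T.exists_isInducedRanking hT
      exact ⟨_, σ, hσ, rfl⟩
    · rintro _ ⟨σ, hσ, rfl⟩
      rw [huniv]
      exact cost_le_invOn hσ (pairwise_ofFn_symm σ)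

end LabelledBinaryTree

/-! ### Balanced nodes and insensitive items -/

/-- About half of the pairs in `B × S` are in increasing order. -/
def Balanced (ρ : Ranking X) (B S : Finset X) : Prop :=
  below ρ B S = B.card * S.card / 2 ∨ below ρ B S = B.card * S.card / 2 + 1

open Classical in
/-- The items whose predecessor in the ranking is on the other side of `(B, S)`, provided that the
ranking is balanced. -/
noncomputable def balancedSplits (ρ : Ranking X) (B S : Finset X) : Finset X :=
  Finset.univ.filter fun w => (∃ u, (ρ u : ℕ) + 1 = ρ w ∧ ((u ∈ B ∧ w ∈ S) ∨ (w ∈ B ∧ u ∈ S))) ∧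
    Balanced ρ B S ∧ Balanced ρ S B

theorem mem_balancedSplits {ρ : Ranking X} {B S : Finset X} {w : X} :
    w ∈ balancedSplits ρ B S ↔
      (∃ u, (ρ u : ℕ) + 1 = ρ w ∧ ((u ∈ B ∧ w ∈ S) ∨ (w ∈ B ∧ u ∈ S))) ∧
        Balanced ρ B S ∧ Balanced ρ S B := by
  simp [balancedSplits]

theorem balancedSplits_comm (ρ : Ranking X) (B S : Finset X) :
    balancedSplits ρ B S = balancedSplits ρ S B := by
  ext w
  simp only [mem_balancedSplits]
  grind

/-- Write `b` and `b'` for the two counts of `ρ`. Those of `τ` are `b - 1` and `b' + 1`, and equal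
minima force `b = b' + 1`. Hence `b + b' = |B| |S|` is odd and `b`, `b'` are the two integers next
to its half. -/
theorem balanced_of_min_eq {ρ τ : Ranking X} {B S : Finset X} (hd : Disjoint B S)
    (h1 : below ρ B S = below τ B S + 1)
    (h : min (below ρ B S) (below ρ S B) = min (below τ B S) (below τ S B)) :
    Balanced ρ B S ∧ Balanced ρ S B := by
  have h2 := below_add_below ρ hd
  have h3 := below_add_below τ hd
  unfold Balanced
  rw [mul_comm S.card]
  omega

namespace LabelledBinaryTree

/-- The items `w` for which some node of the tree separates `w` from its predecessor and is
balanced. -/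
noncomputable def splits [DecidableEq X] (ρ : Ranking X) : LabelledBinaryTree X → Finset X
  | leaf _ => ∅
  | unary t => t.splits ρ
  | node l r => l.splits ρ ∪ r.splits ρ ∪ balancedSplits ρ l.leafSet r.leafSet

theorem cost_swap_of_not_mem [DecidableEq X] {ρ : Ranking X} {u w : X}
    (h : (ρ u : ℕ) + 1 = ρ w) {T : LabelledBinaryTree X}
    (hT : ¬ (u ∈ T.leafSet ∧ w ∈ T.leafSet)) :
    T.cost ((Equiv.swap u w).trans ρ) = T.cost ρ := by
  induction T with
  | leaf x => rfl
  | unary t ih => exact ih hT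
  | node l r ihl ihr =>
    simp only [mem_leafSet_node] at hT
    rw [cost, cost, ihl (by tauto), ihr (by tauto), below_swap_of_not_split h (by tauto) (by tauto),
      below_swap_of_not_split h (by tauto) (by tauto)]

/-- All terms of the cost except the one at the node separating `u` from `w` survive the exchange,
so equality of the costs descends to that node. -/
theorem mem_splits_of_cost_swap_eq [DecidableEq X] {ρ : Ranking X} {u w : X}
    (h : (ρ u : ℕ) + 1 = ρ w) {T : LabelledBinaryTree X} (hT : T.leaves.Nodup)
    (hu : u ∈ T.leafSet) (hw : w ∈ T.leafSet)
    (hcost : T.cost ((Equiv.swap u w).trans ρ) = T.cost ρ) : w ∈ T.splits ρ := by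
  induction T with
  | leaf x =>
    simp only [mem_leafSet, leaves, List.mem_singleton] at hu hw
    rw [hu, hw] at h
    omega
  | unary t ih => exact ih hT hu hw hcost
  | node l r ihl ihr =>
    have hd := disjoint_leafSet hT
    have hnl : l.leaves.Nodup := (List.nodup_append.1 hT).1
    have hnr : r.leaves.Nodup := (List.nodup_append.1 hT).2.1
    simp only [mem_leafSet_node] at hu hw
    have hl : ∀ {x}, x ∈ r.leafSet → x ∉ l.leafSet := fun hx => Finset.disjoint_right.1 hd hx
    have hr : ∀ {x}, x ∈ l.leafSet → x ∉ r.leafSet := fun hx => Finset.disjoint_left.1 hd hx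
    simp only [splits, Finset.mem_union]
    simp only [cost] at hcost
    rcases hu with hu | hu <;> rcases hw with hw | hw
    · rw [cost_swap_of_not_mem h (T := r) (fun hc => hr hu hc.1),
        below_swap_of_not_split h (fun hc => hr hw hc.2) (fun hc => hr hu hc.2),
        below_swap_of_not_split h (fun hc => hr hu hc.1) (fun hc => hr hw hc.1)] at hcost
      exact Or.inl (Or.inl (ihl hnl hu hw (by omega)))
    · rw [cost_swap_of_not_mem h (T := l) (fun hc => hl hw hc.2),
        cost_swap_of_not_mem h (T := r) (fun hc => hr hu hc.1)] at hcost
      exact Or.inr (mem_balancedSplits.2 ⟨⟨u, h, Or.inl ⟨hu, hw⟩⟩,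
        balanced_of_min_eq hd (below_swap_of_split h hd hu hw) (by omega)⟩)
    · rw [cost_swap_of_not_mem h (T := l) (fun hc => hl hu hc.1),
        cost_swap_of_not_mem h (T := r) (fun hc => hr hw hc.2)] at hcost
      exact Or.inr (mem_balancedSplits.2 ⟨⟨u, h, Or.inr ⟨hw, hu⟩⟩,
        (balanced_of_min_eq hd.symm (below_swap_of_split h hd.symm hu hw) (by omega)).symm⟩)
    · rw [cost_swap_of_not_mem h (T := l) (fun hc => hl hu hc.1),
        below_swap_of_not_split h (fun hc => hl hu hc.1) (fun hc => hl hw hc.1),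
        below_swap_of_not_split h (fun hc => hl hw hc.2) (fun hc => hl hu hc.2)] at hcost
      exact Or.inl (Or.inr (ihr hnr hu hw (by omega)))

theorem insensitive_minInv_subset [DecidableEq X] {T : LabelledBinaryTree X} (hT : T.HasLeafSet)
    (ρ : Ranking X) : insensitive T.minInv ρ ⊆ T.splits ρ := by
  intro w hw
  simp only [insensitive, Finset.mem_filter, Finset.mem_univ, true_and] at hw
  obtain ⟨u, h, hP⟩ := hw
  rw [minInv_eq_cost hT, minInv_eq_cost hT] at hP
  refine mem_splits_of_cost_swap_eq h hT.1 (mem_leafSet.2 (hT.2 u)) (mem_leafSet.2 (hT.2 w)) ?_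
  -- `insensitive` uses classical decidable equality in its `Equiv.swap`; only the instances differ.
  convert hP

end LabelledBinaryTree

end Cost

/-! ### Anticoncentration of sums of subsets of fixed size -/

section SubsetSums

/-- Squaring keeps the estimate within `ℕ`; the induction step is `(2n+1)(2n+3) ≤ (2n+2)²`. The
reverse estimate below rests on `4n(n+1) ≤ (2n+1)²`. -/
theorem centralBinom_sq_mul_le (n : ℕ) : n.centralBinom ^ 2 * (2 * n + 1) ≤ 16 ^ n := by
  induction n with
  | zero => simp
  | succ n ih =>
    have h := Nat.succ_mul_centralBinom_succ n
    have h2 : (n + 1) ^ 2 * ((n + 1).centralBinom ^ 2 * (2 * (n + 1) + 1)) =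
        4 * (2 * n + 1) * (2 * n + 3) * (n.centralBinom ^ 2 * (2 * n + 1)) := by
      calc _ = ((n + 1) * (n + 1).centralBinom) ^ 2 * (2 * (n + 1) + 1) := by ring
        _ = _ := by rw [h]; ring
    have h3 : (n + 1) ^ 2 * ((n + 1).centralBinom ^ 2 * (2 * (n + 1) + 1)) ≤
        (n + 1) ^ 2 * 16 ^ (n + 1) := by
      rw [h2]
      calc _ ≤ (16 * (n + 1) ^ 2) * 16 ^ n := Nat.mul_le_mul (by nlinarith) ih
        _ = _ := by ring
    exact Nat.le_of_mul_le_mul_left h3 (by positivity)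

theorem le_centralBinom_sq_mul {n : ℕ} (hn : 1 ≤ n) : 16 ^ n ≤ n.centralBinom ^ 2 * (4 * n) := by
  induction n, hn using Nat.le_induction with
  | base => simp [Nat.centralBinom, Nat.choose]
  | succ n hn ih =>
    have h := Nat.succ_mul_centralBinom_succ n
    have h2 : (n + 1) * ((n + 1).centralBinom ^ 2 * (4 * (n + 1))) =
        4 * (4 * (2 * n + 1) ^ 2) * n.centralBinom ^ 2 := by
      calc _ = ((n + 1) * (n + 1).centralBinom) ^ 2 * 4 := by ring
        _ = _ := by rw [h]; ring
    have h3 : (n + 1) * 16 ^ (n + 1) ≤ (n + 1) * ((n + 1).centralBinom ^ 2 * (4 * (n + 1))) := by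
      rw [h2]
      calc (n + 1) * 16 ^ (n + 1) = 16 * (n + 1) * 16 ^ n := by ring
        _ ≤ 16 * (n + 1) * (n.centralBinom ^ 2 * (4 * n)) := Nat.mul_le_mul_left _ ih
        _ = (16 * (4 * n * (n + 1))) * n.centralBinom ^ 2 := by ring
        _ ≤ _ := Nat.mul_le_mul_right _ (by nlinarith)
    exact Nat.le_of_mul_le_mul_left h3 (by positivity)

theorem choose_half_sq_mul_le (n : ℕ) : n.choose (n / 2) ^ 2 * (n + 1) ≤ 4 ^ n := by
  rcases Nat.even_or_odd' n with ⟨m, rfl | rfl⟩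
  · have := centralBinom_sq_mul_le m
    rw [Nat.centralBinom_eq_two_mul_choose] at this
    rw [Nat.mul_div_cancel_left _ (by norm_num), pow_mul]
    exact this
  · have h := centralBinom_sq_mul_le (m + 1)
    rw [Nat.centralBinom_eq_two_mul_choose, show 2 * (m + 1) = 2 * m + 1 + 1 by ring,
      Nat.choose_succ_succ, Nat.choose_symm_half m] at h
    rw [show (2 * m + 1) / 2 = m by omega]
    set x := (2 * m + 1).choose m
    have h2 : 4 * (x ^ 2 * (2 * m + 1 + 1)) ≤ 4 * ((4 ^ 2) ^ m * 4 ^ 1) := by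
      calc _ ≤ (x + x) ^ 2 * (2 * m + 1 + 1 + 1) := by nlinarith [Nat.zero_le (x ^ 2)]
        _ ≤ 16 ^ (m + 1) := h
        _ = _ := by rw [pow_succ]; norm_num; ring
    rw [pow_add, pow_mul]
    exact Nat.le_of_mul_le_mul_left h2 (by norm_num)

/-- Both sides count the partitions of a set of `2 * (i + p)` elements into labelled cells of sizes
`i`, `p`, `j`, `q`: either the half made of the first two cells is chosen first, or the union of the
cells of sizes `i` and `j`. -/
theorem choose_mul_choose_mul_centralBinom {i j p q : ℕ} (h : i + p = j + q) :
    (i + p).choose i * (j + q).choose j * (i + p).centralBinom =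
      (2 * (i + p)).choose (i + j) * (i + j).choose i * (p + q).choose p := by
  have e : 2 * (i + p) = (i + j) + (p + q) := by omega
  have e' : 2 * (i + p) = (i + p) + (j + q) := by omega
  have key : ∀ a b : ℕ, (a + b).choose a * a.factorial * b.factorial = (a + b).factorial :=
    fun a b => by rw [Nat.choose_symm_add, Nat.add_choose_mul_factorial_mul_factorial]
  have h5 := key (i + j) (p + q)
  have h6 := key (i + p) (j + q)
  rw [Nat.centralBinom_eq_two_mul_choose]
  rw [← e] at h5
  rw [← e'] at h6
  refine Nat.eq_of_mul_eq_mul_right (m := i.factorial * p.factorial * j.factorial * q.factorial *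
    (i + p).factorial * (j + q).factorial) (by positivity) ?_
  calc _ = ((i + p).choose i * i.factorial * p.factorial) *
        ((j + q).choose j * j.factorial * q.factorial) *
        ((2 * (i + p)).choose (i + p) * (i + p).factorial * (j + q).factorial) := by ring
    _ = ((2 * (i + p)).choose (i + j) * ((i + j).choose i * i.factorial * j.factorial) *
        ((p + q).choose p * p.factorial * q.factorial)) *
        ((i + p).factorial * (j + q).factorial) := by
      rw [key, key, key, key, h6, ← h5]
      ring
    _ = _ := by ring

/-- The hypergeometric probability of an even split is small. -/
theorem choose_half_mul_choose_half_le {h c : ℕ} (hc : c ≤ h) :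
    (h.choose (c / 2) * h.choose (c - c / 2)) ^ 2 * (c + 1) ≤ 4 * (2 * h).choose c ^ 2 := by
  rcases Nat.eq_zero_or_pos h with rfl | hpos
  · obtain rfl : c = 0 := by omega
    simp
  set M := h.choose (c / 2) * h.choose (c - c / 2) with hM
  have hid : M * h.centralBinom =
      (2 * h).choose c * c.choose (c / 2) * (2 * h - c).choose (h - c / 2) := by
    have := choose_mul_choose_mul_centralBinom (i := c / 2) (j := c - c / 2) (p := h - c / 2)
      (q := h - (c - c / 2)) (by omega)
    rw [show c / 2 + (h - c / 2) = h by omega, show c - c / 2 + (h - (c - c / 2)) = h by omega,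
      show c / 2 + (c - c / 2) = c by omega,
      show h - c / 2 + (h - (c - c / 2)) = 2 * h - c by omega] at this
    exact this
  have h1 := choose_half_sq_mul_le c
  have h2 : (2 * h - c).choose (h - c / 2) ^ 2 * (2 * h - c + 1) ≤ 4 ^ (2 * h - c) :=
    (Nat.mul_le_mul_right _ (Nat.pow_le_pow_left (Nat.choose_le_middle _ _) 2)).trans
      (choose_half_sq_mul_le _)
  have h3 := le_centralBinom_sq_mul hpos
  have h4 : (4 : ℕ) ^ c * 4 ^ (2 * h - c) = 16 ^ h := by
    rw [← pow_add, show c + (2 * h - c) = 2 * h by omega, pow_mul]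
    norm_num
  -- The spare factor `h` is absorbed by `2 * h - c + 1`; this is where `c ≤ h` enters.
  have key : (h.centralBinom ^ 2 * h) * (M ^ 2 * (c + 1)) ≤
      (h.centralBinom ^ 2 * h) * (4 * (2 * h).choose c ^ 2) := by
    calc _ = (M * h.centralBinom) ^ 2 * (c + 1) * h := by ring
      _ ≤ (M * h.centralBinom) ^ 2 * (c + 1) * (2 * h - c + 1) :=
          Nat.mul_le_mul_left _ (by omega)
      _ = (2 * h).choose c ^ 2 * ((c.choose (c / 2) ^ 2 * (c + 1)) *
            ((2 * h - c).choose (h - c / 2) ^ 2 * (2 * h - c + 1))) := by rw [hid]; ring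
      _ ≤ (2 * h).choose c ^ 2 * (4 ^ c * 4 ^ (2 * h - c)) :=
          Nat.mul_le_mul_left _ (Nat.mul_le_mul h1 h2)
      _ ≤ (2 * h).choose c ^ 2 * (h.centralBinom ^ 2 * (4 * h)) := by
          rw [h4]; exact Nat.mul_le_mul_left _ h3
      _ = _ := by ring
  have hcb := Nat.centralBinom_pos h
  exact Nat.le_of_mul_le_mul_left key (by positivity)

/-- Pairs of sets of total size `c`, such that union and intersection determine the size of the
second set, are at most as many as the pairs of sets of sizes that differ by at most one. -/
theorem card_pairs_le (h c : ℕ) (F : Finset (Finset ℕ × Finset ℕ))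
    (hF : ∀ p ∈ F, p.1 ⊆ Finset.range h ∧ p.2 ⊆ Finset.range h ∧ p.1.card + p.2.card = c)
    (hdet : ∀ p ∈ F, ∀ q ∈ F, p.1 ∪ p.2 = q.1 ∪ q.2 → p.1 ∩ p.2 = q.1 ∩ q.2 →
      p.2.card = q.2.card) :
    F.card ≤ h.choose (c / 2) * h.choose (c - c / 2) := by
  let R := Finset.range h
  let G := R.powersetCard (c - c / 2) ×ˢ R.powersetCard (c / 2)
  -- `F` and `G` are compared fibrewise over the pair (union `U`, intersection `T`). Inside a fibre
  -- a pair is determined by `p.2 \ T`, a subset of `U \ T` whose size is constant on `F` by `hdet`.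
  -- The middle binomial coefficient bounds the number of these subsets, and `G` attains it in every
  -- nonempty fibre of `F`.
  let f : Finset ℕ × Finset ℕ → Finset ℕ × Finset ℕ := fun p => (p.1 ∪ p.2, p.1 ∩ p.2)
  have hG : G.card = h.choose (c / 2) * h.choose (c - c / 2) := by
    simp [G, R, mul_comm]
  rw [← hG]
  have hFm : ∀ p ∈ F, f p ∈ R.powerset ×ˢ R.powerset := by
    intro p hp
    obtain ⟨h1, h2, -⟩ := hF p hp
    simp only [f, Finset.mem_product, Finset.mem_powerset]
    exact ⟨Finset.union_subset h1 h2, Finset.inter_subset_left.trans h1⟩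
  have hGm : ∀ p ∈ G, f p ∈ R.powerset ×ˢ R.powerset := by
    intro p hp
    simp only [G, Finset.mem_product, Finset.mem_powersetCard] at hp
    simp only [f, Finset.mem_product, Finset.mem_powerset]
    exact ⟨Finset.union_subset hp.1.1 hp.2.1, Finset.inter_subset_left.trans hp.1.1⟩
  rw [Finset.card_eq_sum_card_fiberwise hFm, Finset.card_eq_sum_card_fiberwise hGm]
  apply Finset.sum_le_sum
  rintro ⟨U, T⟩ -
  rcases (F.filter fun p => f p = (U, T)).eq_empty_or_nonempty with he | ⟨p₀, hp₀⟩
  · rw [he]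
    simp
  rw [Finset.mem_filter] at hp₀
  obtain ⟨hp₀, hf⟩ := hp₀
  simp only [f, Prod.mk.injEq] at hf
  obtain ⟨hU, hT⟩ := hf
  obtain ⟨h1, h2, h3⟩ := hF p₀ hp₀
  have hTU : T ⊆ U := by
    rw [← hU, ← hT]
    exact Finset.inter_subset_union
  have hUR : U ⊆ R := by
    rw [← hU]
    exact Finset.union_subset h1 h2
  have hcard : U.card + T.card = c := by
    rw [← hU, ← hT, Finset.card_union_add_card_inter, h3]
  have hm : (U \ T).card = U.card - T.card := Finset.card_sdiff_of_subset hTU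
  have hle : T.card ≤ U.card := Finset.card_le_card hTU
  calc (F.filter fun p => f p = (U, T)).card
      ≤ ((U \ T).powersetCard (p₀.2.card - T.card)).card := by
        apply Finset.card_le_card_of_injOn (fun p => p.2 \ T)
        · intro p hp
          simp only [Finset.coe_filter, Set.mem_ofPred_eq, f, Prod.mk.injEq] at hp
          obtain ⟨hpF, hpU, hpT⟩ := hp
          have hTp : T ⊆ p.2 := by rw [← hpT]; exact Finset.inter_subset_right
          simp only [Finset.mem_coe, Finset.mem_powersetCard]
          refine ⟨Finset.sdiff_subset_sdiff (by rw [← hpU]; exact Finset.subset_union_right)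
            (le_refl _), ?_⟩
          rw [Finset.card_sdiff_of_subset hTp, hdet p hpF p₀ hp₀ (hpU.trans hU.symm)
            (hpT.trans hT.symm)]
        · intro p hp q hq hpq
          simp only [Finset.coe_filter, Set.mem_ofPred_eq, f, Prod.mk.injEq] at hp hq hpq
          obtain ⟨-, hpU, hpT⟩ := hp
          obtain ⟨-, hqU, hqT⟩ := hq
          simp only [Finset.ext_iff, Finset.mem_union, Finset.mem_inter, Finset.mem_sdiff]
            at hpU hpT hqU hqT hpq
          ext x
          · have := hpU x; have := hpT x; have := hqU x; have := hqT x; have := hpq x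
            grind
          · have := hpU x; have := hpT x; have := hqU x; have := hqT x; have := hpq x
            grind
    _ ≤ ((U \ T).powersetCard ((U \ T).card / 2)).card := by
        rw [Finset.card_powersetCard, Finset.card_powersetCard]
        exact Nat.choose_le_middle _ _
    -- Since `|U \ T| = c - 2 |T|`, adding half of `U \ T` to `T` gives a set of size exactly `c /
    -- 2`.
    _ ≤ _ := by
        apply Finset.card_le_card_of_injOn (fun B => (T ∪ ((U \ T) \ B), T ∪ B))
        · intro B hB
          simp only [Finset.mem_coe, Finset.mem_powersetCard] at hB
          obtain ⟨hB, hBc⟩ := hB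
          have hBU : B ⊆ U := hB.trans Finset.sdiff_subset
          have hdT : Disjoint T B := (Finset.disjoint_of_subset_left hB Finset.sdiff_disjoint).symm
          have hdT' : Disjoint T ((U \ T) \ B) :=
            (Finset.disjoint_of_subset_left Finset.sdiff_subset Finset.sdiff_disjoint).symm
          simp only [Finset.coe_filter, Set.mem_ofPred_eq, G, Finset.mem_product,
            Finset.mem_powersetCard, f, Prod.mk.injEq]
          refine ⟨⟨⟨?_, ?_⟩, ?_, ?_⟩, ?_, ?_⟩
          · exact Finset.union_subset (hTU.trans hUR)
              ((Finset.sdiff_subset.trans Finset.sdiff_subset).trans hUR)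
          · rw [Finset.card_union_of_disjoint hdT', Finset.card_sdiff_of_subset hB]
            omega
          · exact Finset.union_subset (hTU.trans hUR) (hBU.trans hUR)
          · rw [Finset.card_union_of_disjoint hdT]
            omega
          · ext x
            have := @hTU x; have := @hBU x
            simp only [Finset.mem_union, Finset.mem_sdiff]
            tauto
          · ext x
            simp only [Finset.mem_union, Finset.mem_sdiff, Finset.mem_inter]
            tauto
        · intro B hB B' hB' hBB'
          simp only [Finset.mem_coe, Finset.mem_powersetCard] at hB hB'
          have h2 := (Prod.mk.inj hBB').2
          have hd : Disjoint T B :=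
            (Finset.disjoint_of_subset_left hB.1 Finset.sdiff_disjoint).symm
          have hd' : Disjoint T B' :=
            (Finset.disjoint_of_subset_left hB'.1 Finset.sdiff_disjoint).symm
          rw [← Finset.union_sdiff_cancel_left hd, h2, Finset.union_sdiff_cancel_left hd']

/-- The lower half and the shifted upper half of a set of numbers below `2 * h`. -/
def halves (h : ℕ) (W : Finset ℕ) : Finset ℕ × Finset ℕ :=
  ((Finset.range h).filter fun i => i ∈ W, (Finset.range h).filter fun i => i + h ∈ W)

theorem eq_union_halves (h : ℕ) (W : Finset ℕ) :
    W = ((halves h W).1 ∪ (halves h W).2.map (addRightEmbedding h)) ∪ W.filter (2 * h ≤ ·) := by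
  ext x
  simp only [halves, Finset.mem_union, Finset.mem_map, Finset.mem_filter, Finset.mem_range,
    addRightEmbedding_apply]
  constructor
  · intro hx
    rcases lt_or_ge x h with h1 | h1
    · exact Or.inl (Or.inl ⟨h1, hx⟩)
    rcases lt_or_ge x (2 * h) with h2 | h2
    · exact Or.inl (Or.inr ⟨x - h, ⟨by omega, by rwa [Nat.sub_add_cancel h1]⟩,
        Nat.sub_add_cancel h1⟩)
    · exact Or.inr ⟨hx, h2⟩
  · rintro ((⟨-, hx⟩ | ⟨y, ⟨-, hy⟩, rfl⟩) | ⟨hx, -⟩) <;> assumption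

theorem sum_eq_sum_halves (h : ℕ) (W : Finset ℕ) (g : ℕ → ℕ) :
    ∑ i ∈ W, g i = ∑ i ∈ (halves h W).1, g i + ∑ i ∈ (halves h W).2, g (i + h) +
      ∑ i ∈ W.filter (2 * h ≤ ·), g i := by
  conv_lhs => rw [eq_union_halves h W]
  rw [Finset.sum_union, Finset.sum_union, Finset.sum_map]
  · simp
  · rw [Finset.disjoint_left]
    intro x hx hx'
    simp only [halves, Finset.mem_map, Finset.mem_filter, Finset.mem_range,
      addRightEmbedding_apply] at hx hx'
    obtain ⟨y, -, rfl⟩ := hx'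
    omega
  · rw [Finset.disjoint_left]
    intro x hx hx'
    simp only [halves, Finset.mem_union, Finset.mem_map, Finset.mem_filter, Finset.mem_range,
      addRightEmbedding_apply] at hx hx'
    obtain ⟨h1, -⟩ | ⟨y, ⟨h1, -⟩, rfl⟩ := hx <;> omega

/-- If `W` has halves `(P, Q)`, its sum is `∑ P + ∑ Q + h * |Q| + ∑ R`. Union and intersection of
`P` and `Q` fix `∑ P + ∑ Q`, and a window of length `h` then leaves one value for `|Q|`, so
`card_pairs_le` applies. The fixed rest `R` accommodates the extra element of an interval of odd
length. -/
theorem card_sum_mem_Ico_le_of_rest (h c k : ℕ) (R : Finset ℕ) (F : Finset (Finset ℕ))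
    (hF : ∀ W ∈ F, W.card = c + R.card ∧ W.filter (2 * h ≤ ·) = R ∧
      k ≤ ∑ i ∈ W, i ∧ ∑ i ∈ W, i < k + h) :
    F.card ≤ h.choose (c / 2) * h.choose (c - c / 2) := by
  have hinj : Set.InjOn (halves h) F := by
    intro W hW W' hW' hWW'
    rw [eq_union_halves h W, eq_union_halves h W', hWW', (hF W hW).2.1,
      (hF W' hW').2.1]
  rw [← Finset.card_image_of_injOn hinj]
  apply card_pairs_le
  · intro p hp
    obtain ⟨W, hW, rfl⟩ := Finset.mem_image.1 hp
    refine ⟨Finset.filter_subset _ _, Finset.filter_subset _ _, ?_⟩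
    have := sum_eq_sum_halves h W fun _ => 1
    simp only [Finset.sum_const, smul_eq_mul, mul_one, (hF W hW).1, (hF W hW).2.1] at this
    omega
  · intro p hp q hq hU hI
    obtain ⟨W, hW, rfl⟩ := Finset.mem_image.1 hp
    obtain ⟨W', hW', rfl⟩ := Finset.mem_image.1 hq
    obtain ⟨-, hR, h1, h2⟩ := hF W hW
    obtain ⟨-, hR', h1', h2'⟩ := hF W' hW'
    have e := sum_eq_sum_halves h W fun i => i
    have e' := sum_eq_sum_halves h W' fun i => i
    have s := Finset.sum_union_inter (s₁ := (halves h W).1) (s₂ := (halves h W).2)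
      (f := fun i : ℕ => i)
    have s' := Finset.sum_union_inter (s₁ := (halves h W').1) (s₂ := (halves h W').2)
      (f := fun i : ℕ => i)
    rw [← hU, ← hI, s] at s'
    simp only [Finset.sum_add_distrib, Finset.sum_const, smul_eq_mul, hR, hR'] at e e'
    set a := (halves h W).2.card
    set b := (halves h W').2.card
    rcases lt_trichotomy a b with hab | hab | hab
    · have := Nat.mul_le_mul_right h (Nat.succ_le_of_lt hab)
      rw [Nat.succ_mul] at this
      omega
    · exact hab
    · have := Nat.mul_le_mul_right h (Nat.succ_le_of_lt hab)
      rw [Nat.succ_mul] at this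
      omega

theorem choose_half_mul_choose_half_le_real {h c : ℕ} (hc : c ≤ h) :
    ((h.choose (c / 2) * h.choose (c - c / 2) : ℕ) : ℝ) * √(c + 1 : ℝ) ≤
      2 * ((2 * h).choose c : ℝ) := by
  have := choose_half_mul_choose_half_le hc
  apply le_of_sq_le_sq _ (by positivity)
  rw [mul_pow, Real.sq_sqrt (by positivity), mul_pow]
  norm_num
  exact_mod_cast this

/-- The sums of the subsets of size `c` of an interval of `N` numbers are spread out. -/
theorem card_sum_mem_Ico_le {h c N : ℕ} (hc : c ≤ h) (hN : N = 2 * h ∨ N = 2 * h + 1) (k : ℕ) :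
    ((((Finset.range N).powersetCard c).filter fun W =>
      k ≤ ∑ i ∈ W, i ∧ ∑ i ∈ W, i < k + h).card : ℝ) * √(c + 1 : ℝ) ≤ 4 * (N.choose c : ℝ) := by
  rcases hN with rfl | rfl
  · have h1 := card_sum_mem_Ico_le_of_rest h c k ∅
      (((Finset.range (2 * h)).powersetCard c).filter fun W =>
        k ≤ ∑ i ∈ W, i ∧ ∑ i ∈ W, i < k + h) (by
      intro W hW
      simp only [Finset.mem_filter, Finset.mem_powersetCard] at hW
      refine ⟨by simpa using hW.1.2, ?_, hW.2⟩
      rw [Finset.filter_eq_empty_iff]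
      intro x hx
      simpa using hW.1.1 hx)
    have h2 := choose_half_mul_choose_half_le_real hc
    have h3 : (0 : ℝ) ≤ ((2 * h).choose c : ℝ) := by positivity
    calc _ ≤ ((h.choose (c / 2) * h.choose (c - c / 2) : ℕ) : ℝ) * √(c + 1 : ℝ) := by gcongr
      _ ≤ _ := by linarith
  · rcases Nat.eq_zero_or_pos c with rfl | hpos
    · have h1 : (((Finset.range (2 * h + 1)).powersetCard 0).filter fun W =>
          k ≤ ∑ i ∈ W, i ∧ ∑ i ∈ W, i < k + h).card ≤ 1 :=
        (Finset.card_filter_le _ _).trans (by simp)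
      have h1' : ((((Finset.range (2 * h + 1)).powersetCard 0).filter fun W =>
          k ≤ ∑ i ∈ W, i ∧ ∑ i ∈ W, i < k + h).card : ℝ) ≤ 1 := by exact_mod_cast h1
      simp only [Nat.cast_zero, zero_add, Real.sqrt_one, mul_one, Nat.choose_zero_right,
        Nat.cast_one]
      linarith
    obtain ⟨d, rfl⟩ : ∃ d, c = d + 1 := ⟨c - 1, by omega⟩
    set F := ((Finset.range (2 * h + 1)).powersetCard (d + 1)).filter fun W =>
        k ≤ ∑ i ∈ W, i ∧ ∑ i ∈ W, i < k + h with hFdef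
    have hF1 := card_sum_mem_Ico_le_of_rest h (d + 1) k ∅ (F.filter fun W => 2 * h ∉ W) (by
      intro W hW
      simp only [hFdef, Finset.mem_filter, Finset.mem_powersetCard] at hW
      refine ⟨by simpa using hW.1.1.2, ?_, hW.1.2⟩
      rw [Finset.filter_eq_empty_iff]
      intro x hx hx'
      have h1 := Finset.mem_range.1 (hW.1.1.1 hx)
      have h2 : x = 2 * h := by omega
      exact hW.2 (h2 ▸ hx))
    have hF2 := card_sum_mem_Ico_le_of_rest h d k {2 * h} (F.filter fun W => ¬ 2 * h ∉ W) (by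
      intro W hW
      simp only [hFdef, Finset.mem_filter, Finset.mem_powersetCard, not_not] at hW
      refine ⟨by simpa using hW.1.1.2, ?_, hW.1.2⟩
      ext x
      simp only [Finset.mem_filter, Finset.mem_singleton]
      constructor
      · rintro ⟨hx, hx'⟩
        have h1 := Finset.mem_range.1 (hW.1.1.1 hx)
        omega
      · rintro rfl
        exact ⟨hW.2, le_refl _⟩)
    -- For odd `N` the sets with and without the last element `2 * h` are counted separately and
    -- recombined by Pascal's rule. Replacing `√(d + 2)` by `2 * √(d + 1)` doubles the constant from
    -- 2 to 4.
    have hsplit : F.card = (F.filter fun W => 2 * h ∉ W).card +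
        (F.filter fun W => ¬ 2 * h ∉ W).card :=
      (Finset.card_filter_add_card_filter_not _).symm
    have hFle : (F.card : ℝ) ≤ ((h.choose ((d + 1) / 2) * h.choose (d + 1 - (d + 1) / 2) : ℕ) : ℝ) +
        ((h.choose (d / 2) * h.choose (d - d / 2) : ℕ) : ℝ) := by
      exact_mod_cast hsplit.le.trans (Nat.add_le_add hF1 hF2)
    have h1 := choose_half_mul_choose_half_le_real hc
    have h2 := choose_half_mul_choose_half_le_real (c := d) (h := h) (by omega)
    have hs : √((d + 1 : ℕ) + 1 : ℝ) ≤ 2 * √(d + 1 : ℝ) := by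
      rw [Real.sqrt_le_left (by positivity), mul_pow, Real.sq_sqrt (by positivity)]
      push_cast
      nlinarith
    have hchoose : ((2 * h + 1).choose (d + 1) : ℝ) =
        ((2 * h).choose d : ℝ) + ((2 * h).choose (d + 1) : ℝ) := by
      rw [Nat.choose_succ_succ]
      push_cast
      rfl
    have h3 : (0 : ℝ) ≤ ((2 * h).choose (d + 1) : ℝ) := by positivity
    rw [hchoose]
    calc _ ≤ (((h.choose ((d + 1) / 2) * h.choose (d + 1 - (d + 1) / 2) : ℕ) : ℝ) +
        ((h.choose (d / 2) * h.choose (d - d / 2) : ℕ) : ℝ)) * √((d + 1 : ℕ) + 1 : ℝ) := by gcongr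
      _ = ((h.choose ((d + 1) / 2) * h.choose (d + 1 - (d + 1) / 2) : ℕ) : ℝ) *
            √((d + 1 : ℕ) + 1 : ℝ) +
          ((h.choose (d / 2) * h.choose (d - d / 2) : ℕ) : ℝ) * √((d + 1 : ℕ) + 1 : ℝ) := by ring
      _ ≤ 2 * ((2 * h).choose (d + 1) : ℝ) +
          ((h.choose (d / 2) * h.choose (d - d / 2) : ℕ) : ℝ) * (2 * √(d + 1 : ℝ)) := by gcongr
      _ ≤ _ := by nlinarith

end SubsetSums

/-! ### Distribution of `below` over random rankings -/

section Averaging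

/-- The image of a set under a uniformly random permutation is uniformly distributed. -/
theorem card_perm_map_mem {A : Type*} [Fintype A] [DecidableEq A] (S : Finset A)
    (F : Finset (Finset A)) (hF : ∀ W ∈ F, W.card = S.card) :
    (Finset.univ.filter fun π : Equiv.Perm A => S.map π.toEmbedding ∈ F).card *
      (Fintype.card A).choose S.card = F.card * (Fintype.card A).factorial := by
  let m : Finset A → ℕ := fun W =>
    (Finset.univ.filter fun π : Equiv.Perm A => S.map π.toEmbedding = W).card
  have hle : ∀ W W' : Finset A, W.card = W'.card → m W ≤ m W' := by
    intro W W' h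
    obtain ⟨g, hg⟩ := Equiv.Perm.exists_map_finset_eq W W' h
    apply Finset.card_le_card_of_injOn (fun π => π.trans g)
    · intro π hπ
      simp only [Finset.coe_filter, Finset.mem_univ, true_and, Set.mem_ofPred_eq] at hπ ⊢
      rw [← hg, ← hπ, Finset.map_map]
      rfl
    · intro π _ π' _ h
      ext x
      have := congrArg (fun e : Equiv.Perm A => e x) h
      simpa using this
  have hm : ∀ W : Finset A, W.card = S.card → m W = m S := fun W h =>
    le_antisymm (hle W S h) (hle S W h.symm)
  have hcount : ∀ G : Finset (Finset A), (∀ W ∈ G, W.card = S.card) →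
      (Finset.univ.filter fun π : Equiv.Perm A => S.map π.toEmbedding ∈ G).card =
        G.card * m S := by
    intro G hG
    have hmaps : Set.MapsTo (fun π : Equiv.Perm A => S.map π.toEmbedding)
        (Finset.univ.filter fun π : Equiv.Perm A => S.map π.toEmbedding ∈ G) G :=
      fun π hπ => (Finset.mem_filter.1 (Finset.mem_coe.1 hπ)).2
    rw [Finset.card_eq_sum_card_fiberwise hmaps, ← smul_eq_mul, ← Finset.sum_const]
    apply Finset.sum_congr rfl
    intro W hW
    rw [← hm W (hG W hW), Finset.filter_filter]
    congr 1
    ext π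
    simp only [Finset.mem_filter, Finset.mem_univ, true_and]
    exact ⟨fun h => h.2, fun h => ⟨h ▸ hW, h⟩⟩
  have hall := hcount (Finset.univ.powersetCard S.card)
    (fun W hW => (Finset.mem_powersetCard.1 hW).2)
  have huniv : (Finset.univ.filter fun π : Equiv.Perm A =>
      S.map π.toEmbedding ∈ (Finset.univ : Finset A).powersetCard S.card) = Finset.univ := by
    ext π
    simp [Finset.mem_powersetCard]
  rw [huniv, Finset.card_univ, Fintype.card_perm, Finset.card_powersetCard, Finset.card_univ]
    at hall
  rw [hcount F hF, hall]
  ring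

variable {X : Type*} [Fintype X]

/-- Exactly one of a pair of distinct items and its reversal is counted. Hence `below ρ S S` does
not depend on `ρ`, and it serves as the constant between `below ρ B S` and a sum of positions. -/
theorem two_mul_below_self [DecidableEq X] (ρ : Ranking X) (S : Finset X) :
    2 * below ρ S S = S.offDiag.card := by
  have h1 : S.offDiag.filter (fun p => ρ p.1 < ρ p.2) =
      (S ×ˢ S).filter fun p => ρ p.1 < ρ p.2 := by
    ext ⟨x, y⟩
    simp only [Finset.mem_filter, Finset.mem_offDiag, Finset.mem_product]
    exact ⟨fun h => ⟨⟨h.1.1, h.1.2.1⟩, h.2⟩,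
      fun h => ⟨⟨h.1.1, h.1.2, fun hc => h.2.ne (congrArg ρ hc)⟩, h.2⟩⟩
  rw [← Finset.card_filter_add_card_filter_not (s := S.offDiag) (fun p => ρ p.1 < ρ p.2), h1,
    two_mul, below]
  congr 1
  refine Finset.card_bij' (fun p _ => p.swap) (fun p _ => p.swap) ?_ ?_ (by simp) (by simp)
  · rintro ⟨x, y⟩ hp
    simp only [Finset.mem_filter, Finset.mem_product, Finset.mem_offDiag, Prod.swap_prod_mk,
      not_lt] at hp ⊢
    exact ⟨⟨hp.1.2, hp.1.1, fun hc => hp.2.ne (congrArg ρ hc).symm⟩, hp.2.le⟩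
  · rintro ⟨x, y⟩ hp
    simp only [Finset.mem_filter, Finset.mem_product, Finset.mem_offDiag, Prod.swap_prod_mk,
      not_lt] at hp ⊢
    exact ⟨⟨hp.1.2.1, hp.1.1⟩, lt_of_le_of_ne hp.2 fun hc => hp.1.2.2 (ρ.injective hc).symm⟩

theorem below_eq_sum (ρ : Ranking X) (B S : Finset X) :
    below ρ B S = ∑ z ∈ S, (B.filter fun x => ρ x < ρ z).card := by
  unfold below
  rw [Finset.card_filter, Finset.sum_product_right]
  simp_rw [Finset.card_filter]

/-- The number of items of `A` that are ranked below `z`. -/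
def index (ρ : Ranking X) (A : Finset X) (z : X) : ℕ := (A.filter fun x => ρ x < ρ z).card

theorem index_lt_index {ρ : Ranking X} {A : Finset X} {x y : X} (hx : x ∈ A) (h : ρ x < ρ y) :
    index ρ A x < index ρ A y := by
  apply Finset.card_lt_card
  rw [Finset.ssubset_iff_of_subset]
  · exact ⟨x, by simp [hx, h], by simp⟩
  · intro z hz
    rw [Finset.mem_filter] at hz ⊢
    exact ⟨hz.1, hz.2.trans h⟩

theorem index_injOn (ρ : Ranking X) (A : Finset X) : Set.InjOn (index ρ A) A := by
  intro x hx y hy h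
  rcases lt_trichotomy (ρ x) (ρ y) with h' | h' | h'
  · exact absurd h (index_lt_index hx h').ne
  · exact ρ.injective h'
  · exact absurd h (index_lt_index hy h').ne'

theorem index_lt_card {ρ : Ranking X} {A : Finset X} {x : X} (hx : x ∈ A) :
    index ρ A x < A.card := by
  apply Finset.card_lt_card
  rw [Finset.ssubset_iff_of_subset (Finset.filter_subset _ _)]
  exact ⟨x, hx, by simp⟩

/-- Counting pairs after a permutation of the items of `A` amounts to summing positions in `A`. -/
theorem below_perm_add [DecidableEq X] (ρ : Ranking X) {B S A : Finset X} (hd : Disjoint B S)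
    (hA : B ∪ S = A) (π : Equiv.Perm {x // x ∈ A}) :
    below ((Equiv.Perm.ofSubtype π).trans ρ) B S + S.offDiag.card / 2 =
      ∑ z ∈ (S.subtype (· ∈ A)).map π.toEmbedding, index ρ A z := by
  set τ : Ranking X := (Equiv.Perm.ofSubtype π).trans ρ with hτ
  have hS : ∀ z ∈ S, z ∈ A := fun z hz => hA ▸ Finset.mem_union_right _ hz
  rw [← two_mul_below_self τ S, Nat.mul_div_cancel_left _ (by norm_num), below_eq_sum,
    below_eq_sum, ← Finset.sum_add_distrib, Finset.sum_map]
  -- The position of an item of `S` within `A` counts the items of `B` and those of `S` below it;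
  -- summed over `S`, the second part is the constant `below τ S S`.
  have hidx : ∀ z ∈ S, (B.filter fun x => τ x < τ z).card + (S.filter fun x => τ x < τ z).card =
      index ρ A (Equiv.Perm.ofSubtype π z) := by
    intro z hz
    rw [← Finset.card_union_of_disjoint (Finset.disjoint_filter_filter hd), ← Finset.filter_union,
      hA, index]
    have hmem : ∀ x, Equiv.Perm.ofSubtype π x ∈ A ↔ x ∈ A :=
      fun x => Equiv.Perm.ofSubtype_apply_mem_iff_mem π x
    refine Finset.card_bij' (fun x _ => Equiv.Perm.ofSubtype π x)
      (fun x _ => (Equiv.Perm.ofSubtype π).symm x) ?_ ?_ (by simp) (by simp)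
    · intro x hx
      rw [Finset.mem_filter] at hx ⊢
      exact ⟨(hmem x).2 hx.1, hx.2⟩
    · intro x hx
      rw [Finset.mem_filter] at hx ⊢
      refine ⟨(hmem _).1 (by simpa using hx.1), ?_⟩
      simpa [hτ] using hx.2
  rw [Finset.sum_congr rfl hidx]
  refine Finset.sum_bij' (fun z hz => (⟨z, hS z hz⟩ : {x // x ∈ A})) (fun z _ => (z : X)) ?_ ?_
    (by simp) (by simp) ?_
  · intro z hz
    simpa using hz
  · intro z hz
    simpa using hz
  · intro z hz
    simp [Equiv.Perm.ofSubtype_apply_of_mem, hS z hz]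

/-- A random permutation of `A` sends `S` to a uniform subset of size `|S|`, and `index` embeds `A`
into `range |A|`, so the bound for subset sums applies after shifting the window. -/
theorem card_perm_below_mem_Ico_le [DecidableEq X] (ρ : Ranking X) {B S A : Finset X}
    (hd : Disjoint B S) (hA : B ∪ S = A) (hcard : S.card ≤ B.card) (k : ℕ) :
    ((Finset.univ.filter fun π : Equiv.Perm {x // x ∈ A} =>
      k ≤ below ((Equiv.Perm.ofSubtype π).trans ρ) B S ∧
        below ((Equiv.Perm.ofSubtype π).trans ρ) B S < k + A.card / 2).card : ℝ) *
        √(S.card + 1 : ℝ) ≤ 4 * (A.card.factorial : ℝ) := by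
  set S' : Finset {x // x ∈ A} := S.subtype (· ∈ A) with hS'
  set k' := k + S.offDiag.card / 2
  have hSA : S ⊆ A := hA ▸ Finset.subset_union_right
  have hAcard : A.card = B.card + S.card := by rw [← hA, Finset.card_union_of_disjoint hd]
  have hS'card : S'.card = S.card := by
    rw [hS', Finset.card_subtype, Finset.filter_true_of_mem hSA]
  let F : Finset (Finset {x // x ∈ A}) := (Finset.univ.powersetCard S.card).filter fun W =>
    k' ≤ ∑ z ∈ W, index ρ A z ∧ ∑ z ∈ W, index ρ A z < k' + A.card / 2
  have hF : ∀ W ∈ F, W.card = S'.card := by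
    intro W hW
    rw [hS'card]
    exact (Finset.mem_powersetCard.1 (Finset.mem_filter.1 hW).1).2
  have h1 := card_perm_map_mem S' F hF
  have heq : (Finset.univ.filter fun π : Equiv.Perm {x // x ∈ A} =>
      k ≤ below ((Equiv.Perm.ofSubtype π).trans ρ) B S ∧
        below ((Equiv.Perm.ofSubtype π).trans ρ) B S < k + A.card / 2) =
      Finset.univ.filter fun π : Equiv.Perm {x // x ∈ A} => S'.map π.toEmbedding ∈ F := by
    ext π
    have := below_perm_add ρ hd hA π
    simp only [Finset.mem_filter, Finset.mem_univ, true_and, F, Finset.mem_powersetCard,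
      Finset.subset_univ, Finset.card_map, hS'card]
    rw [← this]
    omega
  let e : {x // x ∈ A} ↪ ℕ :=
    ⟨fun z => index ρ A z, fun x y h => Subtype.ext (index_injOn ρ A x.2 y.2 h)⟩
  have h2 : F.card ≤ (((Finset.range A.card).powersetCard S.card).filter fun W =>
      k' ≤ ∑ i ∈ W, i ∧ ∑ i ∈ W, i < k' + A.card / 2).card := by
    apply Finset.card_le_card_of_injOn (fun W => W.map e)
    · intro W hW
      simp only [F, Finset.coe_filter, Finset.mem_powersetCard, Set.mem_ofPred_eq] at hW ⊢
      rw [Finset.sum_map, Finset.card_map]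
      refine ⟨⟨?_, hW.1.2⟩, hW.2⟩
      intro x hx
      obtain ⟨z, -, rfl⟩ := Finset.mem_map.1 hx
      exact Finset.mem_range.2 (index_lt_card z.2)
    · intro W _ W' _ h
      exact Finset.map_injective e h
  have h3 := card_sum_mem_Ico_le (h := A.card / 2) (c := S.card) (N := A.card) (by omega)
    (by omega) k'
  have h4 : (F.card : ℝ) * √(S.card + 1 : ℝ) ≤ 4 * (A.card.choose S.card : ℝ) :=
    le_trans (by gcongr) h3
  rw [heq]
  rw [hS'card, Fintype.card_coe] at h1
  set p := (Finset.univ.filter fun π : Equiv.Perm {x // x ∈ A} => S'.map π.toEmbedding ∈ F).card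
  have h1' : (p : ℝ) * (A.card.choose S.card : ℝ) = F.card * (A.card.factorial : ℝ) := by
    exact_mod_cast h1
  have hpos : (0 : ℝ) < (A.card.choose S.card : ℝ) := by
    exact_mod_cast Nat.choose_pos (Finset.card_le_card hSA)
  refine le_of_mul_le_mul_right ?_ hpos
  calc _ = (F.card : ℝ) * √(S.card + 1 : ℝ) * (A.card.factorial : ℝ) := by
        rw [mul_right_comm, h1']; ring
    _ ≤ 4 * (A.card.choose S.card : ℝ) * (A.card.factorial : ℝ) := by gcongr
    _ = _ := by ring

open Classical in
/-- The rankings with `y` at the bottom. -/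
noncomputable def bottomRankings (y : X) : Finset (Ranking X) :=
  Finset.univ.filter fun τ => (τ y : ℕ) = 0

theorem mem_bottomRankings {y : X} {τ : Ranking X} : τ ∈ bottomRankings y ↔ (τ y : ℕ) = 0 := by
  simp [bottomRankings]

theorem card_mul_card_bottomRankings (y : X) :
    Fintype.card X * (bottomRankings y).card = (Fintype.card X).factorial := by
  classical
  have hle : ∀ a b : X, (bottomRankings a).card ≤ (bottomRankings b).card := by
    intro a b
    apply Finset.card_le_card_of_injOn (fun τ => (Equiv.swap a b).trans τ)
    · intro τ hτ
      rw [Finset.mem_coe, mem_bottomRankings] at hτ ⊢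
      simpa using hτ
    · intro τ _ τ' _ h
      ext x
      have := congrArg (fun e : Ranking X => e (Equiv.swap a b x)) h
      simp only [Equiv.trans_apply, Equiv.swap_apply_self] at this
      rw [this]
  have hpos : 0 < Fintype.card X := Fintype.card_pos_iff.2 ⟨y⟩
  have hfib := Finset.card_eq_sum_card_fiberwise (s := (Finset.univ : Finset (Ranking X)))
    (t := (Finset.univ : Finset X)) (f := fun τ => τ.symm ⟨0, hpos⟩) (fun _ _ => Finset.mem_coe.2 (Finset.mem_univ _))
  have heq : ∀ a : X, (Finset.univ.filter fun τ : Ranking X => τ.symm ⟨0, hpos⟩ = a).card =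
      (bottomRankings y).card := by
    intro a
    rw [le_antisymm (hle y a) (hle a y), bottomRankings]
    congr 1
    ext τ
    simp only [Finset.mem_filter, Finset.mem_univ, true_and, Equiv.symm_apply_eq, Fin.ext_iff]
    exact eq_comm
  simp only [heq, Finset.sum_const, Finset.card_univ, smul_eq_mul] at hfib
  rw [← hfib, Fintype.card_equiv (Fintype.equivFin X)]

/-- Since `y ∉ B ∪ S`, permuting the items of `B ∪ S` preserves the rankings with `y` at the bottom.
Averaging over these permutations reduces the claim to one fixed ranking. -/
theorem card_bottom_below_mem_Ico_le [DecidableEq X] {y : X} {B S : Finset X} (hd : Disjoint B S)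
    (hyB : y ∉ B) (hyS : y ∉ S) (hcard : S.card ≤ B.card) (k : ℕ) :
    (((bottomRankings y).filter fun τ =>
      k ≤ below τ B S ∧ below τ B S < k + (B ∪ S).card / 2).card : ℝ) * √(S.card + 1 : ℝ) ≤
        4 * ((bottomRankings y).card : ℝ) := by
  set A := B ∪ S with hA
  let P : Ranking X → Prop := fun τ => k ≤ below τ B S ∧ below τ B S < k + A.card / 2
  let hdec : DecidablePred P := fun τ => instDecidableAnd
  have hbij : ∀ π : Equiv.Perm {x // x ∈ A},
      ((bottomRankings y).filter fun τ => P ((Equiv.Perm.ofSubtype π).trans τ)).card =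
        ((bottomRankings y).filter P).card := by
    intro π
    have hy : Equiv.Perm.ofSubtype π y = y :=
      Equiv.Perm.ofSubtype_apply_of_not_mem π (by simp [hA, hyB, hyS])
    refine Finset.card_bij' (fun τ _ => (Equiv.Perm.ofSubtype π).trans τ)
      (fun τ _ => (Equiv.Perm.ofSubtype π).symm.trans τ) ?_ ?_ ?_ ?_
    · intro τ hτ
      rw [Finset.mem_filter, mem_bottomRankings] at hτ ⊢
      exact ⟨by rw [Equiv.trans_apply, hy]; exact hτ.1, hτ.2⟩
    · intro τ hτ
      rw [Finset.mem_filter, mem_bottomRankings] at hτ ⊢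
      refine ⟨?_, ?_⟩
      · rw [Equiv.trans_apply, show (Equiv.Perm.ofSubtype π).symm y = y by
          rw [Equiv.symm_apply_eq, hy]]
        exact hτ.1
      · rw [← Equiv.trans_assoc, Equiv.self_trans_symm, Equiv.refl_trans]
        exact hτ.2
    · intro τ _
      rw [← Equiv.trans_assoc, Equiv.symm_trans_self, Equiv.refl_trans]
    · intro τ _
      rw [← Equiv.trans_assoc, Equiv.self_trans_symm, Equiv.refl_trans]
  have hdouble : A.card.factorial * ((bottomRankings y).filter P).card =
      ∑ τ ∈ bottomRankings y, (Finset.univ.filter fun π : Equiv.Perm {x // x ∈ A} =>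
        P ((Equiv.Perm.ofSubtype π).trans τ)).card := by
    simp_rw [Finset.card_filter]
    rw [Finset.sum_comm]
    simp_rw [← Finset.card_filter, hbij]
    rw [Finset.sum_const, Finset.card_univ, Fintype.card_perm, Fintype.card_coe, smul_eq_mul]
  have hfact : (0 : ℝ) < (A.card.factorial : ℝ) := by positivity
  have hmain : (A.card.factorial : ℝ) * (((bottomRankings y).filter P).card * √(S.card + 1 : ℝ)) ≤
      (A.card.factorial : ℝ) * (4 * ((bottomRankings y).card : ℝ)) := by
    calc _ = ((A.card.factorial * ((bottomRankings y).filter P).card : ℕ) : ℝ) *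
          √(S.card + 1 : ℝ) := by push_cast; ring
      _ = ∑ τ ∈ bottomRankings y, ((Finset.univ.filter fun π : Equiv.Perm {x // x ∈ A} =>
            P ((Equiv.Perm.ofSubtype π).trans τ)).card : ℝ) * √(S.card + 1 : ℝ) := by
          rw [hdouble, Nat.cast_sum, Finset.sum_mul]
      _ ≤ ∑ τ ∈ bottomRankings y, 4 * (A.card.factorial : ℝ) := by
          apply Finset.sum_le_sum
          intro τ _
          exact card_perm_below_mem_Ico_le τ hd rfl hcard k
      _ = _ := by rw [Finset.sum_const, nsmul_eq_mul]; ring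
  exact le_of_mul_le_mul_left hmain hfact

theorem card_bottom_below_mem_Icc_le [DecidableEq X] {y : X} {B S : Finset X} (hd : Disjoint B S)
    (hyB : y ∉ B) (hyS : y ∉ S) (hcard : S.card < B.card) (k : ℕ) :
    (((bottomRankings y).filter fun τ =>
      k ≤ below τ B S ∧ below τ B S ≤ k + B.card).card : ℝ) * √(S.card + 1 : ℝ) ≤
        16 * ((bottomRankings y).card : ℝ) := by
  rcases S.eq_empty_or_nonempty with rfl | hS
  · have h : (((bottomRankings y).filter fun τ =>
      k ≤ below τ B ∅ ∧ below τ B ∅ ≤ k + B.card).card : ℝ) ≤ (bottomRankings y).card := by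
      exact_mod_cast Finset.card_filter_le _ _
    have h0 : (0 : ℝ) ≤ ((bottomRankings y).card : ℝ) := by positivity
    simp only [Finset.card_empty, Nat.cast_zero, zero_add, Real.sqrt_one, mul_one]
    linarith
  · have hpos := hS.card_pos
    have hA : (B ∪ S).card = B.card + S.card := Finset.card_union_of_disjoint hd
    -- As `S` is nonempty, `4 * h ≥ 2 * |B| > |B|`, so four windows of length `h` cover the closed
    -- window; this turns the constant 4 into 16.
    set h := (B ∪ S).card / 2 with hh
    let G : ℕ → Finset (Ranking X) := fun j => (bottomRankings y).filter fun τ =>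
      k + j * h ≤ below τ B S ∧ below τ B S < k + j * h + h
    have hsub : ((bottomRankings y).filter fun τ =>
        k ≤ below τ B S ∧ below τ B S ≤ k + B.card) ⊆ (Finset.range 4).biUnion G := by
      intro τ hτ
      rw [Finset.mem_filter] at hτ
      obtain ⟨h1, h2, h3⟩ := hτ
      have hlt : below τ B S < k + 4 * h := by omega
      simp only [Finset.mem_biUnion, Finset.mem_range, G, Finset.mem_filter]
      by_cases c1 : below τ B S < k + h
      · exact ⟨0, by norm_num, h1, by omega, by omega⟩
      by_cases c2 : below τ B S < k + 2 * h
      · exact ⟨1, by norm_num, h1, by omega, by omega⟩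
      by_cases c3 : below τ B S < k + 3 * h
      · exact ⟨2, by norm_num, h1, by omega, by omega⟩
      · exact ⟨3, by norm_num, h1, by omega, by omega⟩
    have hle : (((bottomRankings y).filter fun τ =>
        k ≤ below τ B S ∧ below τ B S ≤ k + B.card).card : ℝ) ≤
          ∑ j ∈ Finset.range 4, ((G j).card : ℝ) := by
      exact_mod_cast (Finset.card_le_card hsub).trans Finset.card_biUnion_le
    calc _ ≤ (∑ j ∈ Finset.range 4, ((G j).card : ℝ)) * √(S.card + 1 : ℝ) := by gcongr
      _ = ∑ j ∈ Finset.range 4, ((G j).card : ℝ) * √(S.card + 1 : ℝ) := by rw [Finset.sum_mul]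
      _ ≤ ∑ j ∈ Finset.range 4, 4 * ((bottomRankings y).card : ℝ) :=
          Finset.sum_le_sum fun j _ =>
            card_bottom_below_mem_Ico_le hd hyB hyS hcard.le (k + j * h)
      _ = _ := by rw [Finset.sum_const, Finset.card_range, nsmul_eq_mul]; push_cast; ring

end Averaging

/-! ### Deleting an item next to the larger side -/

section Deletion

variable {X : Type*} [Fintype X]

/-- The ranking obtained by moving `y` to the bottom. -/
def moveToBottom (y : X) (ρ : Ranking X) : Ranking X := ρ.trans (ρ y).cycleRange

theorem moveToBottom_self (y : X) (ρ : Ranking X) : (moveToBottom y ρ y : ℕ) = 0 := by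
  rw [moveToBottom, Equiv.trans_apply, Fin.coe_cycleRange_of_le le_rfl, if_pos rfl]

theorem moveToBottom_lt_iff {y : X} (ρ : Ranking X) {a b : X} (ha : a ≠ y) (hb : b ≠ y) :
    moveToBottom y ρ a < moveToBottom y ρ b ↔ ρ a < ρ b := by
  have key : ∀ {c : X}, c ≠ y → (moveToBottom y ρ c : ℕ) =
      if ρ c < ρ y then (ρ c : ℕ) + 1 else ρ c := by
    intro c hc
    rw [moveToBottom, Equiv.trans_apply]
    split_ifs with h
    · exact Fin.coe_cycleRange_of_lt h
    · rw [Fin.cycleRange_of_gt]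
      exact lt_of_le_of_ne (not_lt.1 h) fun h' => hc (ρ.injective h').symm
  rw [Fin.lt_def, key ha, key hb]
  simp only [Fin.lt_def]
  have h1 : (ρ a : ℕ) ≠ ρ y := fun h => ha (ρ.injective (Fin.ext h))
  have h2 : (ρ b : ℕ) ≠ ρ y := fun h => hb (ρ.injective (Fin.ext h))
  split_ifs <;> omega

theorem below_moveToBottom [DecidableEq X] (ρ : Ranking X) {B S : Finset X} {y : X} (hyB : y ∉ B) :
    below (moveToBottom y ρ) B (S.erase y) = below ρ B (S.erase y) := by
  unfold below
  congr 1
  apply Finset.filter_congr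
  rintro ⟨a, b⟩ hp
  rw [Finset.mem_product] at hp
  exact moveToBottom_lt_iff ρ (fun h => hyB (h ▸ hp.1)) (Finset.ne_of_mem_erase hp.2)

theorem below_erase_add_index [DecidableEq X] (ρ : Ranking X) {B S : Finset X} {y : X}
    (hy : y ∈ S) : below ρ B (S.erase y) + index ρ B y = below ρ B S := by
  rw [below_eq_sum, below_eq_sum, index, Finset.sum_erase_add _ _ hy]

/-- If `y` moved up past `z`, it would also move past some `x ∈ B`. The other items keep their
order, so everything in `B` that was below `y` stays below it and `x` is gained: the index would
increase. -/
theorem not_crossing_of_index_eq {ρ τ : Ranking X} {y : X} {B : Finset X} (hyB : y ∉ B)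
    (hagree : ∀ a b, a ≠ y → b ≠ y → (ρ a < ρ b ↔ τ a < τ b))
    (hidx : index ρ B y = index τ B y)
    (h : ∀ z, ρ y < ρ z → τ z < τ y → ∃ x ∈ B, ρ y < ρ x ∧ τ x < τ y) (z : X) :
    ¬ (ρ y < ρ z ∧ τ z < τ y) := by
  rintro ⟨h1, h2⟩
  obtain ⟨x, hxB, hx1, hx2⟩ := h z h1 h2
  have hne : ∀ {a : X}, a ∈ B → a ≠ y := fun ha hc => hyB (hc ▸ ha)
  have : index ρ B y < index τ B y := by
    apply Finset.card_lt_card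
    rw [Finset.ssubset_iff_of_subset]
    · exact ⟨x, by simp [hxB, hx2], by simp [hx1.le]⟩
    · intro a ha
      rw [Finset.mem_filter] at ha ⊢
      have := (hagree a x (hne ha.1) (hne hxB)).1 (ha.2.trans hx1)
      exact ⟨ha.1, this.trans hx2⟩
  omega

/-- The position of `y` is determined by the order of the other items and the number of items of
`B` below `y`, provided that `y` is adjacent to `B` on a given side. -/
theorem eq_of_moveToBottom_eq {ρ τ : Ranking X} {y : X} {B : Finset X} (hyB : y ∉ B)
    (hM : moveToBottom y ρ = moveToBottom y τ) (hidx : index ρ B y = index τ B y)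
    (h1 : (∀ a b, a ≠ y → b ≠ y → (ρ a < ρ b ↔ τ a < τ b)) →
      ∀ z, ρ y < ρ z → τ z < τ y → ∃ x ∈ B, ρ y < ρ x ∧ τ x < τ y)
    (h2 : (∀ a b, a ≠ y → b ≠ y → (τ a < τ b ↔ ρ a < ρ b)) →
      ∀ z, τ y < τ z → ρ z < ρ y → ∃ x ∈ B, τ y < τ x ∧ ρ x < ρ y) : ρ = τ := by
  have hagree : ∀ a b, a ≠ y → b ≠ y → (ρ a < ρ b ↔ τ a < τ b) := by
    intro a b ha hb
    rw [← moveToBottom_lt_iff ρ ha hb, hM, moveToBottom_lt_iff τ ha hb]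
  have hagree' : ∀ a b, a ≠ y → b ≠ y → (τ a < τ b ↔ ρ a < ρ b) :=
    fun a b ha hb => (hagree a b ha hb).symm
  have n1 := not_crossing_of_index_eq hyB hagree hidx (h1 hagree)
  have n2 := not_crossing_of_index_eq hyB hagree' hidx.symm (h2 hagree')
  have hy : ∀ z, ρ z < ρ y ↔ τ z < τ y := by
    intro z
    rcases eq_or_ne z y with rfl | hz
    · simp
    constructor
    · intro h
      rcases lt_trichotomy (τ z) (τ y) with h' | h' | h'
      · exact h'
      · exact absurd (τ.injective h') hz
      · exact absurd ⟨h', h⟩ (n2 z)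
    · intro h
      rcases lt_trichotomy (ρ z) (ρ y) with h' | h' | h'
      · exact h'
      · exact absurd (ρ.injective h') hz
      · exact absurd ⟨h', h⟩ (n1 z)
  apply Ranking.ext_of_lt_iff
  intro a b
  rcases eq_or_ne b y with rfl | hb
  · exact hy a
  rcases eq_or_ne a y with rfl | ha
  · have e1 : ρ a ≠ ρ b := fun hc => hb (ρ.injective hc).symm
    have e2 : τ a ≠ τ b := fun hc => hb (τ.injective hc).symm
    have := hy b
    constructor
    · intro h
      exact lt_of_le_of_ne (not_lt.1 fun hc => h.not_gt (this.2 hc)) e2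
    · intro h
      exact lt_of_le_of_ne (not_lt.1 fun hc => h.not_gt (this.1 hc)) e1
  · exact hagree a b ha hb

/-- Moving `y` to the bottom stands for deleting it without changing the type of rankings. The map
is injective on `F`: `κ` and the image give the index of `y`, and `hF`, which expresses adjacency to
`B` on a fixed side, gives its position. The index is at most `|B|`, so the image lies in a window
of that length. -/
theorem card_le_of_adjacent [DecidableEq X] {B S : Finset X} (hd : Disjoint B S)
    (hcard : S.card ≤ B.card) {y : X} (hy : y ∈ S) (κ : ℕ) (F : Finset (Ranking X))
    (hκ : ∀ ρ ∈ F, below ρ B S = κ)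
    (hF : ∀ ρ ∈ F, ∀ τ ∈ F, (∀ a b, a ≠ y → b ≠ y → (ρ a < ρ b ↔ τ a < τ b)) →
      ∀ z, ρ y < ρ z → τ z < τ y → ∃ x ∈ B, ρ y < ρ x ∧ τ x < τ y) :
    (F.card : ℝ) * √(S.card : ℝ) ≤ 16 * ((bottomRankings y).card : ℝ) := by
  have hyB : y ∉ B := Finset.disjoint_right.1 hd hy
  have hpos : 0 < S.card := Finset.card_pos.2 ⟨y, hy⟩
  have hSe : (S.erase y).card + 1 = S.card := Finset.card_erase_add_one hy
  have hidxle : ∀ ρ : Ranking X, index ρ B y ≤ B.card := fun ρ => Finset.card_filter_le _ _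
  -- For `κ < |B|` the truncated subtraction turns the window into `[0, |B|]`, which still contains
  -- all possible values.
  have hle : F.card ≤ ((bottomRankings y).filter fun τ =>
      κ - B.card ≤ below τ B (S.erase y) ∧
        below τ B (S.erase y) ≤ κ - B.card + B.card).card := by
    apply Finset.card_le_card_of_injOn (moveToBottom y)
    · intro ρ hρ
      rw [Finset.mem_coe, Finset.mem_filter, mem_bottomRankings, below_moveToBottom ρ hyB]
      have h1 := below_erase_add_index ρ (B := B) hy
      have h2 := hidxle ρ
      have h3 := hκ ρ hρ
      exact ⟨moveToBottom_self y ρ, by omega, by omega⟩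
    · intro ρ hρ τ hτ h
      refine eq_of_moveToBottom_eq hyB h ?_ (hF ρ hρ τ hτ) (hF τ hτ ρ hρ)
      have h1 := below_erase_add_index ρ (B := B) hy
      have h2 := below_erase_add_index τ (B := B) hy
      rw [hκ ρ hρ, ← below_moveToBottom ρ hyB, h, below_moveToBottom τ hyB] at h1
      rw [hκ τ hτ] at h2
      omega
  have h := card_bottom_below_mem_Icc_le (y := y) (B := B) (S := S.erase y)
    (Finset.disjoint_of_subset_right (Finset.erase_subset _ _) hd) hyB (by simp) (by omega)
    (κ - B.card)
  have hS : ((S.erase y).card + 1 : ℝ) = S.card := by exact_mod_cast hSe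
  rw [hS] at h
  exact le_trans (by gcongr) h

theorem card_le_of_adjacent_balanced [DecidableEq X] {B S : Finset X} (hd : Disjoint B S)
    (hcard : S.card ≤ B.card) {y : X} (hy : y ∈ S) (F : Finset (Ranking X))
    (hbal : ∀ ρ ∈ F, Balanced ρ B S)
    (hF : ∀ ρ ∈ F, ∀ τ ∈ F, (∀ a b, a ≠ y → b ≠ y → (ρ a < ρ b ↔ τ a < τ b)) →
      ∀ z, ρ y < ρ z → τ z < τ y → ∃ x ∈ B, ρ y < ρ x ∧ τ x < τ y) :
    (F.card : ℝ) * √(S.card : ℝ) ≤ 32 * ((bottomRankings y).card : ℝ) := by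
  set m := B.card * S.card / 2
  have h1 := card_le_of_adjacent hd hcard hy m (F.filter fun ρ => below ρ B S = m)
    (fun ρ hρ => (Finset.mem_filter.1 hρ).2) fun ρ hρ τ hτ =>
      hF ρ (Finset.mem_filter.1 hρ).1 τ (Finset.mem_filter.1 hτ).1
  have h2 := card_le_of_adjacent hd hcard hy (m + 1) (F.filter fun ρ => ¬ below ρ B S = m)
    (fun ρ hρ => (hbal ρ (Finset.mem_filter.1 hρ).1).resolve_left (Finset.mem_filter.1 hρ).2)
    fun ρ hρ τ hτ => hF ρ (Finset.mem_filter.1 hρ).1 τ (Finset.mem_filter.1 hτ).1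
  have h3 : (F.card : ℝ) = ((F.filter fun ρ => below ρ B S = m).card : ℝ) +
      ((F.filter fun ρ => ¬ below ρ B S = m).card : ℝ) := by
    exact_mod_cast (Finset.card_filter_add_card_filter_not _).symm
  rw [h3, add_mul]
  linarith

open Classical in
/-- The items of `S` directly above an item of `B`. -/
noncomputable def coversOf (ρ : Ranking X) (B S : Finset X) : Finset X :=
  S.filter fun y => (∃ x ∈ B, (ρ x : ℕ) + 1 = ρ y) ∧ Balanced ρ B S

open Classical in
/-- The items of `S` directly below an item of `B`. -/
noncomputable def coveredBy (ρ : Ranking X) (B S : Finset X) : Finset X :=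
  S.filter fun y => (∃ x ∈ B, (ρ y : ℕ) + 1 = ρ x) ∧ Balanced ρ B S

/-- Each split is charged to its endpoint in `S`, which is either `w` itself or its predecessor.
Charging to `S` makes the later sum run over the smaller side. -/
theorem card_balancedSplits_le (ρ : Ranking X) (B S : Finset X) :
    (balancedSplits ρ B S).card ≤ (coversOf ρ B S).card + (coveredBy ρ B S).card := by
  classical
  let p : X → X := fun w => if h : ∃ u, (ρ u : ℕ) + 1 = ρ w then h.choose else w
  have hp : ∀ {u w}, (ρ u : ℕ) + 1 = ρ w → p w = u := by
    intro u w h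
    have h' : ∃ u, (ρ u : ℕ) + 1 = ρ w := ⟨u, h⟩
    simp only [p, h', dif_pos]
    have := h'.choose_spec
    exact ρ.injective (Fin.ext (by omega))
  have hsub : balancedSplits ρ B S ⊆ coversOf ρ B S ∪
      (balancedSplits ρ B S).filter fun w => ∃ u ∈ S, (ρ u : ℕ) + 1 = ρ w ∧ w ∈ B := by
    intro w hw
    obtain ⟨⟨u, hu, hu'⟩, hb, -⟩ := mem_balancedSplits.1 hw
    rcases hu' with ⟨h1, h2⟩ | ⟨h1, h2⟩
    · exact Finset.mem_union_left _ (Finset.mem_filter.2 ⟨h2, ⟨u, h1, hu⟩, hb⟩)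
    · exact Finset.mem_union_right _ (Finset.mem_filter.2 ⟨hw, u, h2, hu, h1⟩)
  have hle : ((balancedSplits ρ B S).filter fun w =>
      ∃ u ∈ S, (ρ u : ℕ) + 1 = ρ w ∧ w ∈ B).card ≤ (coveredBy ρ B S).card := by
    apply Finset.card_le_card_of_injOn p
    · intro w hw
      obtain ⟨hw, u, huS, hu, hwB⟩ := Finset.mem_filter.1 hw
      rw [hp hu]
      exact Finset.mem_filter.2 ⟨huS, ⟨w, hwB, hu⟩, (mem_balancedSplits.1 hw).2.1⟩
    · intro w hw w' hw' h
      obtain ⟨-, u, -, hu, -⟩ := Finset.mem_filter.1 hw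
      obtain ⟨-, u', -, hu', -⟩ := Finset.mem_filter.1 hw'
      rw [hp hu, hp hu'] at h
      subst h
      exact ρ.injective (Fin.ext (by omega))
  exact (Finset.card_le_card hsub).trans ((Finset.card_union_le _ _).trans (by omega))

theorem sum_card_filter_le [DecidableEq X] {S : Finset X} (P : Ranking X → X → Prop)
    [∀ ρ, DecidablePred (P ρ)] {M : ℝ}
    (h : ∀ y ∈ S, ((Finset.univ.filter fun ρ => P ρ y).card : ℝ) * √(S.card : ℝ) ≤ M) :
    (∑ ρ, ((S.filter fun y => P ρ y).card : ℝ)) ≤ √(S.card : ℝ) * M := by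
  classical
  rcases S.eq_empty_or_nonempty with rfl | hS
  · simp
  have hpos : (0 : ℝ) < √(S.card : ℝ) := Real.sqrt_pos.2 (by exact_mod_cast hS.card_pos)
  have hswap : (∑ ρ, ((S.filter fun y => P ρ y).card : ℝ)) =
      ∑ y ∈ S, ((Finset.univ.filter fun ρ => P ρ y).card : ℝ) := by
    simp_rw [Finset.card_filter]
    push_cast
    rw [Finset.sum_comm]
  refine le_of_mul_le_mul_right ?_ hpos
  calc _ = ∑ y ∈ S, ((Finset.univ.filter fun ρ => P ρ y).card : ℝ) * √(S.card : ℝ) := by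
        rw [hswap, Finset.sum_mul]
    _ ≤ ∑ y ∈ S, M := Finset.sum_le_sum h
    _ = √(S.card : ℝ) * √(S.card : ℝ) * M := by
        rw [Finset.sum_const, nsmul_eq_mul, Real.mul_self_sqrt (by positivity)]
    _ = _ := by ring

theorem sum_card_balancedSplits_le_of_le [DecidableEq X] {B S : Finset X} (hd : Disjoint B S)
    (hcard : S.card ≤ B.card) :
    (Fintype.card X : ℝ) * ∑ ρ : Ranking X, ((balancedSplits ρ B S).card : ℝ) ≤
      64 * √(S.card : ℝ) * ((Fintype.card X).factorial : ℝ) := by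
  classical
  set n := Fintype.card X with hn
  rcases Nat.eq_zero_or_pos n with h0 | hpos
  · have h0' : (Fintype.card X : ℝ) = 0 := by exact_mod_cast h0
    rw [h0', zero_mul]
    positivity
  have hbot : ∀ y : X, ((bottomRankings y).card : ℝ) = (n.factorial : ℝ) / n := by
    intro y
    rw [eq_div_iff (by positivity), mul_comm]
    exact_mod_cast card_mul_card_bottomRankings y
  have h1 : (∑ ρ : Ranking X, ((coversOf ρ B S).card : ℝ)) ≤
      √(S.card : ℝ) * (32 * ((n.factorial : ℝ) / n)) := by
    apply sum_card_filter_le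
    intro y hy
    rw [← hbot y]
    apply card_le_of_adjacent_balanced hd hcard hy
    · intro ρ hρ
      exact (Finset.mem_filter.1 hρ).2.2
    · intro ρ _ τ hτ hagree z hz1 hz2
      -- The witness is the predecessor `x` of `y` in `τ`: no item fits between them, so `z` is not
      -- above `x` in `τ`, and hence not in `ρ`.
      obtain ⟨-, ⟨x, hx, hxy⟩, -⟩ := Finset.mem_filter.1 hτ
      have hxy' : τ x < τ y := by rw [Fin.lt_def]; omega
      refine ⟨x, hx, ?_, hxy'⟩
      by_contra hc
      have hxz : ρ x < ρ z := (not_lt.1 hc).trans_lt hz1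
      have := (hagree x z (fun h => by simp [h] at hxy) (fun h => by simp [h] at hz1)).1 hxz
      rw [Fin.lt_def] at this hz2
      omega
  have h2 : (∑ ρ : Ranking X, ((coveredBy ρ B S).card : ℝ)) ≤
      √(S.card : ℝ) * (32 * ((n.factorial : ℝ) / n)) := by
    apply sum_card_filter_le
    intro y hy
    rw [← hbot y]
    apply card_le_of_adjacent_balanced hd hcard hy
    · intro ρ hρ
      exact (Finset.mem_filter.1 hρ).2.2
    · intro ρ hρ τ _ hagree z hz1 hz2
      -- On the other side the witness is the successor of `y` in `ρ`.
      obtain ⟨-, ⟨x, hx, hxy⟩, -⟩ := Finset.mem_filter.1 hρ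
      have hxy' : ρ y < ρ x := by rw [Fin.lt_def]; omega
      refine ⟨x, hx, hxy', ?_⟩
      by_contra hc
      have hzx : τ z < τ x := hz2.trans_le (not_lt.1 hc)
      have := (hagree z x (fun h => by simp [h] at hz1) (fun h => by simp [h] at hxy)).2 hzx
      rw [Fin.lt_def] at this hz1
      omega
  have h3 : (∑ ρ : Ranking X, ((balancedSplits ρ B S).card : ℝ)) ≤
      ∑ ρ : Ranking X, ((coversOf ρ B S).card : ℝ) +
        ∑ ρ : Ranking X, ((coveredBy ρ B S).card : ℝ) := by
    rw [← Finset.sum_add_distrib]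
    exact Finset.sum_le_sum fun ρ _ => by exact_mod_cast card_balancedSplits_le ρ B S
  have hn0 : (n : ℝ) ≠ 0 := by positivity
  calc _ ≤ (n : ℝ) * (√(S.card : ℝ) * (32 * ((n.factorial : ℝ) / n)) +
        √(S.card : ℝ) * (32 * ((n.factorial : ℝ) / n))) := by gcongr; linarith
    _ = _ := by field_simp; ring

theorem sum_card_balancedSplits_le [DecidableEq X] {B S : Finset X} (hd : Disjoint B S) :
    (Fintype.card X : ℝ) * ∑ ρ : Ranking X, ((balancedSplits ρ B S).card : ℝ) ≤
      64 * √(min B.card S.card : ℕ) * ((Fintype.card X).factorial : ℝ) := by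
  rcases le_total S.card B.card with h | h
  · rw [min_eq_right h]
    exact sum_card_balancedSplits_le_of_le hd h
  · rw [min_eq_left h]
    simp_rw [balancedSplits_comm _ B S]
    exact sum_card_balancedSplits_le_of_le hd.symm h

end Deletion

/-! ### Summation over the tree and the final count -/

section LowerBound

variable {X : Type*} [Fintype X]

/-- Squaring `√a + √b / 2` and using `b ≤ √a * √b` gives `√(a + b) ≤ √a + √b / 2`. -/
theorem sqrt_add_le {a b : ℝ} (hb : 0 ≤ b) (hab : b ≤ a) :
    2 * √(a + b) + √b ≤ 2 * √a + 2 * √b := by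
  have ha : 0 ≤ a := hb.trans hab
  have h : √(a + b) ≤ √a + √b / 2 := by
    rw [Real.sqrt_le_left (by positivity)]
    have h1 := Real.sq_sqrt ha
    have h2 := Real.sq_sqrt hb
    have h3 := Real.sqrt_le_sqrt hab
    nlinarith [Real.sqrt_nonneg b]
  linarith

theorem sqrt_min_add_sqrt_add_le (a b : ℕ) :
    √(min a b : ℕ) + 2 * √(a + b : ℕ) ≤ 2 * √(a : ℝ) + 2 * √(b : ℝ) := by
  rcases le_total a b with h | h
  · have := sqrt_add_le (Nat.cast_nonneg a) (Nat.cast_le (α := ℝ).2 h)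
    rw [min_eq_left h, Nat.cast_add, add_comm (a : ℝ)]
    linarith
  · have := sqrt_add_le (Nat.cast_nonneg b) (Nat.cast_le (α := ℝ).2 h)
    rw [min_eq_right h, Nat.cast_add]
    linarith

namespace LabelledBinaryTree

/-- The potential `f m = 2 * m - 2 * √m` satisfies `f a + f b + √(min a b) ≤ f (a + b)`; without the
subtracted root the induction would not close. -/
theorem sum_card_splits_le [DecidableEq X] {T : LabelledBinaryTree X} (hT : T.leaves.Nodup) :
    (Fintype.card X : ℝ) * ∑ ρ : Ranking X, ((T.splits ρ).card : ℝ) ≤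
      64 * ((Fintype.card X).factorial : ℝ) * (2 * T.leafSet.card - 2 * √(T.leafSet.card : ℝ)) := by
  induction T with
  | leaf x => simp [splits, leafSet, leaves]
  | unary t ih => exact ih hT
  | node l r ihl ihr =>
    have hd := disjoint_leafSet hT
    have h1 := ihl (List.nodup_append.1 hT).1
    have h2 := ihr (List.nodup_append.1 hT).2.1
    have h3 := sum_card_balancedSplits_le hd
    have hcard : (node l r).leafSet.card = l.leafSet.card + r.leafSet.card := by
      rw [leafSet_node, Finset.card_union_of_disjoint hd]
    have h4 := sqrt_min_add_sqrt_add_le l.leafSet.card r.leafSet.card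
    have hsum : (∑ ρ : Ranking X, (((node l r).splits ρ).card : ℝ)) ≤
        ∑ ρ : Ranking X, ((l.splits ρ).card : ℝ) + ∑ ρ : Ranking X, ((r.splits ρ).card : ℝ) +
          ∑ ρ : Ranking X, ((balancedSplits ρ l.leafSet r.leafSet).card : ℝ) := by
      rw [← Finset.sum_add_distrib, ← Finset.sum_add_distrib]
      apply Finset.sum_le_sum
      intro ρ _
      rw [splits]
      have := Finset.card_union_le (l.splits ρ ∪ r.splits ρ)
        (balancedSplits ρ l.leafSet r.leafSet)
      have := Finset.card_union_le (l.splits ρ) (r.splits ρ)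
      exact_mod_cast (by omega : (l.splits ρ ∪ r.splits ρ ∪
        balancedSplits ρ l.leafSet r.leafSet).card ≤ (l.splits ρ).card + (r.splits ρ).card +
          (balancedSplits ρ l.leafSet r.leafSet).card)
    have hf : (0 : ℝ) ≤ ((Fintype.card X).factorial : ℝ) := by positivity
    have hn : (0 : ℝ) ≤ (Fintype.card X : ℝ) := by positivity
    rw [hcard]
    have h5 := mul_le_mul_of_nonneg_left hsum hn
    have h6 := mul_le_mul_of_nonneg_left h4 (mul_nonneg (by norm_num : (0 : ℝ) ≤ 64) hf)
    rw [Nat.cast_add (R := ℝ)] at h6 ⊢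
    linarith

theorem sum_card_insensitive_le [DecidableEq X] {T : LabelledBinaryTree X} (hT : T.HasLeafSet)
    (hX : 0 < Fintype.card X) :
    ∑ ρ : Ranking X, (insensitive T.minInv ρ).card ≤ 128 * (Fintype.card X).factorial := by
  have h1 := sum_card_splits_le hT.1
  rw [leafSet_eq_univ hT, Finset.card_univ] at h1
  have hn : (0 : ℝ) < (Fintype.card X : ℝ) := by exact_mod_cast hX
  have hf : (0 : ℝ) ≤ ((Fintype.card X).factorial : ℝ) := by positivity
  have h2 : (Fintype.card X : ℝ) * ∑ ρ : Ranking X, ((T.splits ρ).card : ℝ) ≤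
      (Fintype.card X : ℝ) * (128 * ((Fintype.card X).factorial : ℝ)) := by
    have := mul_nonneg (mul_nonneg (by norm_num : (0 : ℝ) ≤ 128) hf)
      (Real.sqrt_nonneg (Fintype.card X : ℝ))
    linarith
  have h3 := le_of_mul_le_mul_left h2 hn
  have h4 : ∑ ρ : Ranking X, (T.splits ρ).card ≤ 128 * (Fintype.card X).factorial := by
    exact_mod_cast h3
  exact (Finset.sum_le_sum fun ρ _ =>
    Finset.card_le_card (insensitive_minInv_subset hT ρ)).trans h4

theorem factorial_le_of_solves {T : LabelledBinaryTree X} (hT : T.HasLeafSet)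
    (hX : 0 < Fintype.card X) {A : Algorithm X ℕ} (hA : A.Solves T.minInv) {q : ℕ}
    (hq : ∀ ρ, A.numQueries ρ ≤ q) :
    (Fintype.card X).factorial ≤ 2 ^ (q + 1) * (Fintype.card X + 1) ^ 256 := by
  classical
  let S : Finset (Ranking X) :=
    Finset.univ.filter fun ρ => (insensitive T.minInv ρ).card ≤ 255
  let S' : Finset (Ranking X) :=
    Finset.univ.filter fun ρ => ¬ (insensitive T.minInv ρ).card ≤ 255
  have hcard : S.card + S'.card = (Fintype.card X).factorial := by
    rw [Finset.card_filter_add_card_filter_not, Finset.card_univ,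
      Fintype.card_equiv (Fintype.equivFin X)]
  -- Markov's inequality: the average is at most 128, so at most half of the rankings have 256 or
  -- more insensitive items.
  have hS' : S'.card * 256 ≤ 128 * (Fintype.card X).factorial := by
    refine le_trans ?_ (sum_card_insensitive_le hT hX)
    rw [← smul_eq_mul]
    refine (Finset.card_nsmul_le_sum S' (fun ρ => (insensitive T.minInv ρ).card) 256 ?_).trans
      (Finset.sum_le_sum_of_subset (Finset.subset_univ _))
    intro ρ hρ
    exact not_le.1 (Finset.mem_filter.1 hρ).2
  have hS := card_insensitive_le_of_solves T.minInv A hA q hq 255 S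
    fun ρ hρ => (Finset.mem_filter.1 hρ).2
  calc (Fintype.card X).factorial ≤ 2 * S.card := by omega
    _ ≤ 2 * (2 ^ q * (Fintype.card X + 1) ^ (255 + 1)) := Nat.mul_le_mul_left _ hS
    _ = _ := by ring

theorem logb_factorial_sub_le_queryComplexity {T : LabelledBinaryTree X} (hT : T.HasLeafSet) :
    Real.logb 2 ((Fintype.card X).factorial : ℝ) - 513 * Real.logb 2 (Fintype.card X : ℝ) ≤
      (queryComplexity T.minInv : ℝ) := by
  rcases Nat.lt_or_ge (Fintype.card X) 2 with h | h
  · interval_cases Fintype.card X <;> simp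
  obtain ⟨A, hA, hq⟩ := Nat.sInf_mem (exists_solves T.minInv)
  change ∀ ρ, A.numQueries ρ ≤ queryComplexity T.minInv at hq
  have hmain := factorial_le_of_solves hT (by omega) hA hq
  set q := queryComplexity T.minInv
  set n := Fintype.card X
  -- For `n ≥ 2`, `2 ≤ n` and `n + 1 ≤ n ^ 2`, whence `513 = 1 + 2 * 256`.
  have h1 : n.factorial ≤ 2 ^ q * n ^ 513 := by
    calc n.factorial ≤ 2 ^ (q + 1) * (n + 1) ^ 256 := hmain
      _ ≤ 2 ^ q * n * (n ^ 2) ^ 256 := by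
          rw [pow_succ]
          exact Nat.mul_le_mul (Nat.mul_le_mul_left _ h) (Nat.pow_le_pow_left (by nlinarith) _)
      _ = _ := by ring
  have h2 : (n.factorial : ℝ) ≤ 2 ^ q * (n : ℝ) ^ 513 := by exact_mod_cast h1
  have hn : (n : ℝ) ≠ 0 := by positivity
  have h3 := Real.logb_le_logb_of_le (b := 2) (by norm_num) (by positivity) h2
  rw [Real.logb_mul (by positivity) (by positivity), Real.logb_pow, Real.logb_pow,
    Real.logb_self_eq_one (by norm_num)] at h3
  push_cast at h3
  linarith

end LabelledBinaryTree

end LowerBound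

end InversionMin

theorem mainTheorem1 :
    ∃ C : ℝ, ∀ (X : Type u) [Fintype X] (T : InversionMin.LabelledBinaryTree X), T.HasLeafSet →
      Real.logb 2 ((Fintype.card X).factorial : ℝ) - C * Real.logb 2 (Fintype.card X : ℝ)
        ≤ (InversionMin.queryComplexity T.minInv : ℝ) :=
  ⟨513, fun _ _ _ hT =>
    InversionMin.LabelledBinaryTree.logb_factorial_sub_le_queryComplexity hT⟩
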